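/- **Setting.** Let $U$ be a finite set of $n$ items, $d\ge 1$; item $e$ has a value $v(e)\ge 0$ and a nonzero size $s(e)\in\mathbb{R}_+^d$. Let $\mathscr F\subseteq 2^U$ be a nonempty downward closed family (e.g. the independent sets of a matroid) and let $g:\mathbb{R}_+^d\to\mathbb{R}_+$ be a separable cost function, $g(z)=\sum_i h_i(z_i)$, that is strictly convex and differentiable, with $g(0)=0$, and such that $\langle\nabla g(tw),w\rangle\to\infty$ as $t\to\infty$ for every $w\in\mathbb{R}_+^d\setminus\{0\}$. The profit of $A\subseteq U$ is $\pi(A)=\sum_{e\in A}v(e)-g\big(\sum_{e\in A}s(e)\big)$, and the profit of $y\in[0,1]^U$ is $\pi(y)=\sum_e v(e)y_e-g\big(\sum_e y_e s(e)\big)$. For $A\subseteq U$ let $\mathrm{opt}(A)$ be the maximum of $\pi$ over the sets $X\in\mathscr F$ with $X\subseteq A$, and $\mathrm{fopt}(A)$ the maximum of $\pi$ over the convex hull of the indicator vectors of these sets; $\mathrm{opt}=\mathrm{opt}(U)$. Let $g_i^\star(y)=\sup_{x\ge 0}\,(yx-g(x\mathbf e_i))$ and let $\mathcal C\subseteq\mathbb{R}_+^d$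 be a (continuous) coordinatewise monotone curve that starts at the origin, is unbounded in every coordinate, and satisfies $g_i^\star(\lambda_i)=g_j^\star(\lambda_j)$ for all $\lambda\in\mathcal C$ and all $i,j$. Assume: * general position: for every $\lambda\in\mathcal C$ at most one item satisfies $v(e)=\langle\lambda,s(e)\rangle$; * there are no exceptional items: for no item is $\theta\mapsto\theta v(e)-g(\theta s(e))$ maximized over $[0,1]$ at a point of $(0,1)$; * $\pi(\{e\})\le \mathrm{opt}/(\eta d)$ for every item $e$, for some $\eta\ge 10^4$. **Subroutine.** Let $\alpha>0$ and let SubmodMS be a randomized online algorithm that is told the length of its input sequence, has oracle access to a set function $f$ on $2^U$, only evaluates $f$ at feasible sets (members of $\mathscr F$) of already revealed elements, always returns a set in $\mathscr F$, and is $\alpha$-competitive in the random-order model: for every nonnegative monotone submodular $f$ with $f(\emptyset)=0$ and every $X\subseteq U$, when run on the elements of $X$ in uniformly random order its output $X_{alg}$ satisfies $\mathbb{E}[f(X_{alg})]\ge\frac1\alpha\max\{f(X'):X'\in\mathscr F,\ X'\subseteq X\}$. **Algorithm.** The items of $U$ arrive in uniformly random order. (1) Let $L$ be the set of the first $\mathrm{Binomial}(n,\frac12)$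 items (number drawn independently of the order). (2) Let $\mu$ be the largest vector on $\mathcal C$ with $\mathrm{fopt}(\{e\in L: v(e)\ge\langle\mu,s(e)\rangle\})\ge\frac1{12d}\mathrm{fopt}(L)$ (an arbitrary vector, depending only on $L$, if there is no largest one). (3) Run SubmodMS, with the profit function $\pi$ as its oracle, on the sequence of those remaining items that satisfy $v(e)>\langle\mu,s(e)\rangle$ (its length being the number of these items); select the items that it selects, except those that would decrease the profit of the current solution. **Theorem.** There is a universal constant $K>0$ such that for every such instance, curve and subroutine, the set $A$ selected by the algorithm always belongs to $\mathscr F$ and $$\mathrm{opt}\;\le\;K\,\alpha\,d^2\;\mathbb{E}[\pi(A)],$$ that is, the algorithm is $O(\alpha d^2)$-competitive in expectation. -/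

import Mathlib

noncomputable section

open Set Filter Topology
open scoped NNReal

namespace ConvexProfit

universe u

/-! ### The profit maximization problem -/

/-- The nonnegative orthant `ℝ₊ᵈ`. -/
def orthant (d : ℕ) : Set (Fin d → ℝ) := {z | 0 ≤ z}

/-- The data of an instance: items `U` with values and `d`-dimensional sizes, a cost function
(only its restriction to the nonnegative orthant matters), and a family of feasible sets. -/
structure Instance (d : ℕ) (U : Type u) where
  value : U → ℝ
  size : U → Fin d → ℝ
  cost : (Fin d → ℝ) → ℝ
  feasible : Set (Finset U)

namespace Instance

variable {d : ℕ} {U : Type u} (I : Instance d U)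

/-- `⟨lam, s(e)⟩`. -/
def load (lam : Fin d → ℝ) (e : U) : ℝ := ∑ i, lam i * I.size e i

/-- The profit `v(A) - g(s(A))` of a set of items. -/
def profit (A : Finset U) : ℝ := ∑ e ∈ A, I.value e - I.cost (∑ e ∈ A, I.size e)

/-- The profit `⟨v, y⟩ - g(S y)` of a fractional solution. -/
def fracProfit [Fintype U] (y : U → ℝ) : ℝ :=
  ∑ e, I.value e * y e - I.cost (∑ e, y e • I.size e)

/-- The best profit of a feasible set all of whose items lie in `A`. -/
def opt (A : Finset U) : ℝ := sSup (I.profit '' {X | X ∈ I.feasible ∧ X ⊆ A})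

/-- The best profit of a fractional solution in the convex hull of the indicator vectors of the
feasible sets contained in `A`. -/
def fopt [Fintype U] (A : Finset U) : ℝ :=
  sSup (I.fracProfit '' convexHull ℝ
    ((fun X : Finset U => Set.indicator (X : Set U) (fun _ => (1 : ℝ))) ''
      {X | X ∈ I.feasible ∧ X ⊆ A}))

/-- Values and sizes are nonnegative, no item has size zero in all coordinates, and the feasible
sets form a nonempty downward closed family. -/
structure WellFormed : Prop where
  value_nonneg : ∀ e, 0 ≤ I.value e
  size_nonneg : ∀ e, 0 ≤ I.size e
  size_ne_zero : ∀ e, I.size e ≠ 0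
  empty_feasible : ∅ ∈ I.feasible
  down_closed : ∀ A ∈ I.feasible, ∀ B ⊆ A, B ∈ I.feasible

/-- Item `e` is exceptional if `θ ↦ θ v(e) - g(θ s(e))` is maximized over `[0,1]` at some
`θ ∈ (0,1)`. -/
def Exceptional (e : U) : Prop :=
  ∃ θ ∈ Ioo (0 : ℝ) 1,
    IsMaxOn (fun t : ℝ => t * I.value e - I.cost (t • I.size e)) (Icc 0 1) θ

end Instance

/-- `g` is separable on the nonnegative orthant. -/
def Separable {d : ℕ} (g : (Fin d → ℝ) → ℝ) : Prop :=
  ∃ h : Fin d → ℝ → ℝ, ∀ z ∈ orthant d, g z = ∑ i, h i (z i)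

/-- The regularity assumptions on the cost function `g : ℝ₊ᵈ → ℝ₊`. (Lower semicontinuity of `g`
follows from differentiability.) -/
structure NiceCost {d : ℕ} (g : (Fin d → ℝ) → ℝ) : Prop where
  nonneg : ∀ z ∈ orthant d, 0 ≤ g z
  map_zero : g 0 = 0
  strictConvex : StrictConvexOn ℝ (orthant d) g
  differentiable : DifferentiableOn ℝ g (orthant d)
  /-- Along every ray of the orthant the slope `⟨∇g(t u), u⟩` tends to infinity. -/
  gradient_growth : ∀ w ∈ orthant d, w ≠ 0 →
    Tendsto (fun t : ℝ => fderivWithin ℝ g (orthant d) (t • w) w) atTop atTop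

/-! ### The curve of classifiers -/

/-- The convex dual `g_i^⋆(y) = sup_{x ≥ 0} (y x - g_i(x))` of the `i`-th marginal function
`g_i(x) = g(x e_i)`. The supremum is finite for costs satisfying `NiceCost`. -/
def marginalDual {d : ℕ} (g : (Fin d → ℝ) → ℝ) (i : Fin d) (y : ℝ) : ℝ :=
  sSup ((fun x : ℝ => y * x - g (Pi.single i x)) '' Ici 0)

/-- `C` is a monotone curve in `ℝ₊ᵈ` which starts at the origin, is unbounded in every coordinate
and is balanced: `g_i^⋆(lam_i) = g_j^⋆(lam_j)` for all `lam ∈ C` and all `i`, `j`. -/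
def IsClassifierCurve {d : ℕ} (g : (Fin d → ℝ) → ℝ) (C : Set (Fin d → ℝ)) : Prop :=
  ∃ γ : ℝ≥0 → Fin d → ℝ, Continuous γ ∧ Monotone γ ∧ γ 0 = 0 ∧
    (∀ i, Tendsto (fun t => γ t i) atTop atTop) ∧
    (∀ t i j, marginalDual g i (γ t i) = marginalDual g j (γ t j)) ∧
    C = range γ

namespace Instance

variable {d : ℕ} {U : Type u} (I : Instance d U)

/-- Items are in general position relative to `C`: for each `lam ∈ C` at most one item satisfies
`v(e) = ⟨lam, s(e)⟩`. -/
def GeneralPosition (C : Set (Fin d → ℝ)) : Prop :=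
  ∀ lam ∈ C, {e | I.value e = I.load lam e}.Subsingleton

open Classical in
/-- The items of `A` picked by the classifier `lam`: those with `v(e) ≥ ⟨lam, s(e)⟩`. -/
def picked (A : Finset U) (lam : Fin d → ℝ) : Finset U :=
  A.filter fun e => I.load lam e ≤ I.value e

/-- `thr` implements the threshold computation on a sample `L`: it returns the (coordinatewise)
largest vector `μ ∈ C` with `fopt(L_μ) ≥ fopt(L) / (12 d)`. Nothing is prescribed for samples for
which there is no largest such vector (such as samples with `fopt(L) = 0`, for which every vector
of the unbounded curve qualifies). -/
def IsThresholdRule [Fintype U] (C : Set (Fin d → ℝ)) (thr : Finset U → Fin d → ℝ) : Prop :=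
  ∀ L : Finset U,
    (∃ μ, IsGreatest {μ | μ ∈ C ∧ 1 / (12 * (d : ℝ)) * I.fopt L ≤ I.fopt (I.picked L μ)} μ) →
    IsGreatest {μ | μ ∈ C ∧ 1 / (12 * (d : ℝ)) * I.fopt L ≤ I.fopt (I.picked L μ)} (thr L)

end Instance

/-! ### Online algorithms with oracle access to a set function -/

/-- A randomized online algorithm with oracle access to a set function, as an interactive decision
tree: it can halt, ask for the next element of the input sequence, accept (irrevocably) the element
that was revealed last, query the value of the set function at a set and continue depending on the
answer, or sample from a distribution and continue depending on the outcome. -/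
inductive OnlineAlg (U : Type u) : Type u
  | halt : OnlineAlg U
  | next (k : U → OnlineAlg U) : OnlineAlg U
  | accept (a : OnlineAlg U) : OnlineAlg U
  | query (A : Finset U) (k : ℝ → OnlineAlg U) : OnlineAlg U
  | toss (p : PMF ℕ) (k : ℕ → OnlineAlg U) : OnlineAlg U

namespace OnlineAlg

variable {U : Type u}

/-- The distribution of the list of accepted elements (in order of acceptance) when the algorithm is
run with oracle `f`, where `c` is the element revealed last (if any) and `l` is the list of the
elements still to come. -/
def run (f : Finset U → ℝ) : OnlineAlg U → Option U → List U → PMF (List U)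
  | halt, _, _ => PMF.pure []
  | next _, _, [] => PMF.pure []
  | next k, _, e :: l => run f (k e) (some e) l
  | accept a, none, l => run f a none l
  | accept a, some e, l => (run f a (some e) l).map (e :: ·)
  | query A k, c, l => run f (k (f A)) c l
  | toss p k, c, l => p.bind fun i => run f (k i) c l

/-- Once the elements of `seen` have been revealed, the algorithm only evaluates the oracle at sets
that belong to `F` and consist of revealed elements. -/
def QueriesOnly [DecidableEq U] (F : Set (Finset U)) : OnlineAlg U → Finset U → Prop
  | halt, _ => True
  | next k, seen => ∀ e, e ∉ seen → QueriesOnly F (k e) (insert e seen)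
  | accept a, seen => QueriesOnly F a seen
  | query A k, seen => (A ∈ F ∧ A ⊆ seen) ∧ ∀ r, QueriesOnly F (k r) seen
  | toss p k, seen => ∀ i ∈ p.support, QueriesOnly F (k i) seen

end OnlineAlg

theorem orders_nonempty {U : Type u} [DecidableEq U] (X : Finset U) :
    X.val.lists.toFinset.Nonempty :=
  ⟨X.toList, by simp [Multiset.mem_lists_iff]⟩

/-- The uniformly random order of a finite set. -/
def randomOrder {U : Type u} [DecidableEq U] (X : Finset U) : PMF (List U) :=
  PMF.uniformOfFinset X.val.lists.toFinset (orders_nonempty X)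

/-- The expectation of `h` under a distribution on a finite type. -/
def expect {α : Type u} [Fintype α] (p : PMF α) (h : α → ℝ) : ℝ := ∑ a, (p a).toReal * h a

/-- Nonnegative monotone submodular set functions vanishing at the empty set. -/
structure MonotoneSubmodular {U : Type u} [DecidableEq U] (f : Finset U → ℝ) : Prop where
  nonneg : ∀ A, 0 ≤ f A
  mono : ∀ A B, A ⊆ B → f A ≤ f B
  submodular : ∀ A B, f (A ∪ B) + f (A ∩ B) ≤ f A + f B
  map_empty : f ∅ = 0

/-- `alg` (which is told the number of elements of the input sequence in advance) is an algorithm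
for maximizing over `F` in the random-order model: it only queries feasible sets and only returns
feasible sets, and for every nonnegative monotone submodular function `f` with `f ∅ = 0` and every
set `X` of elements presented in random order, the expected value of the returned set is at least
`1 / α` times the maximum of `f` over the feasible subsets of `X`. -/
structure IsCompetitive {U : Type u} [Fintype U] [DecidableEq U] (F : Set (Finset U)) (α : ℝ)
    (alg : ℕ → OnlineAlg U) : Prop where
  queries_feasible : ∀ N, (alg N).QueriesOnly F ∅
  returns_feasible : ∀ (f : Finset U → ℝ) (l : List U), l.Nodup →
    ∀ a ∈ ((alg l.length).run f none l).support, a.toFinset ∈ F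
  competitive : ∀ f : Finset U → ℝ, MonotoneSubmodular f → ∀ X : Finset U,
    ∀ X' ∈ F, X' ⊆ X →
      1 / α * f X' ≤
        expect ((randomOrder X).bind fun l => ((alg X.card).run f none l).map List.toFinset) f

/-! ### The online algorithm for profit maximization -/

/-- The number of heads in `n` independent fair coin tosses, i.e. a `Binomial(n, 1/2)` variable. -/
def binomialHalf (n : ℕ) : PMF ℕ :=
  (PMF.uniformOfFintype (Fin n → Bool)).map fun c => (Finset.univ.filter fun i => c i = true).card

/-- Go through a list of elements in order, adding each element to the current set unless this
decreases `f`. -/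
def keepImproving {U : Type u} [DecidableEq U] (f : Finset U → ℝ) (l : List U) : Finset U :=
  l.foldl (fun A e => open Classical in if f A ≤ f (insert e A) then insert e A else A) ∅

namespace Instance

variable {d : ℕ} {U : Type u} [Fintype U] [DecidableEq U] (I : Instance d U)

open Classical in
/-- The output distribution of the online algorithm. The items arrive in random order `σ`, the first
`Binomial(n, 1/2)` of them form the sample `L`, on which the threshold `μ = thr L` is computed, and
`alg` is run with the profit function as oracle on the sequence of remaining items with
`v(e) > ⟨μ, s(e)⟩`; the items selected by `alg` are taken unless they decrease the current
profit. -/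
def onlineAlgorithm (thr : Finset U → Fin d → ℝ) (alg : ℕ → OnlineAlg U) : PMF (Finset U) :=
  (randomOrder (Finset.univ : Finset U)).bind fun σ =>
    (binomialHalf (Fintype.card U)).bind fun k =>
      let L := (σ.take k).toFinset
      let R := (σ.drop k).filter fun e => I.load (thr L) e < I.value e
      ((alg R.length).run I.profit none R).map (keepImproving I.profit)

end Instance

end ConvexProfit

end

noncomputable section

open Set Filter Topology
open scoped NNReal

namespace ConvexProfit

universe u

set_option linter.unusedSectionVars false

/-! ### Marginal cost functions -/

section Cost

variable {d : ℕ} {g : (Fin d → ℝ) → ℝ}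

/-! Read a point `μ` of the curve as a price vector. The profit splits into reduced values `v(e) -
⟨μ, s(e)⟩` and coordinatewise gains `ψ_i(x) = μ_i x - g_i(x)`, where `ψ_i` is concave, vanishes at 0
and has supremum `g_i^⋆(μ_i)` (`fracProfit_eq_gain`). A set overflows if its size in some coordinate
lies beyond the point where `ψ_i` stops increasing.

If no feasible set of picked items overflows, everything behaves well. The fractional optimum of
these items is at most `d + 1` times the integral one (`fopt_le_mul_opt`), and on feasible sets the
profit agrees with a monotone submodular function (`exists_monotoneSubmodular`). The subroutine
queries only such sets, so it cannot tell the two functions apart and keeps its guarantee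
(`opt_le_expect_selection`).

If a set of picked items does overflow, scaling it down realizes a full `g_i^⋆(μ_i)` as fractional
profit (`le_fopt_of_overflow`). Let `t₀` be the last time at which `fopt` of the picked items is at
least the common dual value. From `t₀` on nothing strictly picked overflows (`noOverflow_of_le`),
while weak duality gives `fopt(U) ≤ (d + 1) fopt(A₀)` for the set `A₀` picked at `t₀`
(`fopt_univ_le`). Let `t₁` be the last time at which the picked set `A₁` has `fopt` at least
`fopt(U) / (72 d)`.

An optimal fractional solution induces a monotone submodular function of its support. This function
dominates additive weights, so Chebyshev's inequality shows that a random half of a set keeps a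
sixth of its `fopt` (`card_fopt_deviation_mul_le`). With probability at least 1/2 the sample keeps a
sixth of `U` and of `A₀`, and its complement a sixth of `A₁`. The computed threshold then lies
between those at `t₀` and `t₁`: nothing overflows, and enough profit remains outside the sample
(`le_expect_of_good`). The other samples contribute a nonnegative amount. -/

/-- The restriction of `g` to the `i`-th coordinate axis. -/
def axisCost (g : (Fin d → ℝ) → ℝ) (i : Fin d) (x : ℝ) : ℝ := g (Pi.single i x)

theorem single_mem_orthant (i : Fin d) {x : ℝ} (hx : 0 ≤ x) :
    (Pi.single i x : Fin d → ℝ) ∈ orthant d :=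
  Pi.single_nonneg.2 hx

theorem NiceCost.axisCost_zero (hg : NiceCost g) (i : Fin d) : axisCost g i 0 = 0 := by
  simp [axisCost, hg.map_zero]

theorem NiceCost.axisCost_nonneg (hg : NiceCost g) (i : Fin d) {x : ℝ} (hx : 0 ≤ x) :
    0 ≤ axisCost g i x :=
  hg.nonneg _ (single_mem_orthant i hx)

theorem NiceCost.convexOn_axisCost (hg : NiceCost g) (i : Fin d) :
    ConvexOn ℝ (Ici 0) (axisCost g i) := by
  have h := hg.strictConvex.convexOn.comp_linearMap (LinearMap.single ℝ (fun _ : Fin d => ℝ) i)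
  refine h.subset (fun x hx => ?_) (convex_Ici 0)
  exact single_mem_orthant i hx

theorem NiceCost.continuousOn_axisCost (hg : NiceCost g) (i : Fin d) :
    ContinuousOn (axisCost g i) (Ici 0) := by
  have h : Continuous fun x : ℝ => (Pi.single i x : Fin d → ℝ) :=
    (LinearMap.single ℝ (fun _ : Fin d => ℝ) i).continuous_of_finiteDimensional
  exact hg.differentiable.continuousOn.comp h.continuousOn fun _ hx => single_mem_orthant i hx

/-- The summands of a separable cost are determined only up to constants adding to zero; restricting
to the axes normalizes each of them to vanish at 0. -/
theorem Separable.eq_sum_axisCost (hs : Separable g) (h0 : g 0 = 0) {z : Fin d → ℝ}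
    (hz : z ∈ orthant d) : g z = ∑ i, axisCost g i (z i) := by
  obtain ⟨h, hh⟩ := hs
  have hzero : ∑ j, h j 0 = 0 := by
    have := hh 0 (le_refl (0 : Fin d → ℝ))
    simpa [h0] using this.symm
  have key : ∀ i, axisCost g i (z i) = h i (z i) - h i 0 := by
    intro i
    have h1 := hh _ (single_mem_orthant i (hz i))
    have h2 : ∑ j, h j ((Pi.single i (z i) : Fin d → ℝ) j) - ∑ j, h j 0
        = h i (z i) - h i 0 := by
      rw [← Finset.sum_sub_distrib, Finset.sum_eq_single i]
      · simp
      · intro j _ hj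
        simp [Pi.single_eq_of_ne hj]
      · simp
    rw [axisCost, h1, ← h2, hzero, sub_zero]
  rw [hh z hz, Finset.sum_congr rfl fun i _ => key i, Finset.sum_sub_distrib, hzero, sub_zero]

theorem NiceCost.hasDerivWithinAt_axisCost (hg : NiceCost g) (i : Fin d) {t : ℝ} (ht : 0 ≤ t) :
    HasDerivWithinAt (axisCost g i)
      (fderivWithin ℝ g (orthant d) (t • Pi.single i (1 : ℝ)) (Pi.single i 1)) (Ici 0) t := by
  have he : ∀ x : ℝ, (Pi.single i x : Fin d → ℝ) = x • Pi.single i (1 : ℝ) := by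
    intro x
    rw [← Pi.single_smul]
    simp
  have h1 : HasFDerivWithinAt g (fderivWithin ℝ g (orthant d) (t • Pi.single i (1 : ℝ)))
      (orthant d) (t • Pi.single i (1 : ℝ)) :=
    (hg.differentiable _ (he t ▸ single_mem_orthant i ht)).hasFDerivWithinAt
  have h2 : HasDerivWithinAt (fun x : ℝ => x • (Pi.single i (1 : ℝ) : Fin d → ℝ))
      (Pi.single i 1) (Ici 0) t := by
    simpa using ((hasDerivAt_id t).smul_const (Pi.single i (1 : ℝ) : Fin d → ℝ)).hasDerivWithinAt
  have h3 := h1.comp_hasDerivWithinAt t h2 (fun x hx => he x ▸ single_mem_orthant i hx)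
  refine h3.congr_of_mem (fun x _ => ?_) ht
  simp [axisCost, he x]

/-- Gradient growth supplies a point `t` where the slope of `g_i` is at least `y`. By convexity `y x
- g_i(x)` does not increase beyond `t`, and before `t` it is at most `|y| t`. -/
theorem NiceCost.bddAbove_dual (hg : NiceCost g) (i : Fin d) (y : ℝ) :
    BddAbove ((fun x : ℝ => y * x - g (Pi.single i x)) '' Ici 0) := by
  have hw : (Pi.single i (1 : ℝ) : Fin d → ℝ) ≠ 0 := by simp
  have h := hg.gradient_growth _ (single_mem_orthant i zero_le_one) hw
  obtain ⟨t, ht0, hty⟩ := ((eventually_ge_atTop (0 : ℝ)).and (h.eventually_ge_atTop y)).exists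
  refine ⟨max (|y| * t) (y * t), ?_⟩
  rintro _ ⟨x, hx, rfl⟩
  have hx0 : 0 ≤ x := hx
  have hgx : 0 ≤ g (Pi.single i x) := hg.axisCost_nonneg i hx0
  have hgt : 0 ≤ axisCost g i t := hg.axisCost_nonneg i ht0
  rcases le_or_gt x t with hxt | hxt
  · refine le_max_of_le_left ?_
    have h1 : y * x ≤ |y| * x := mul_le_mul_of_nonneg_right (le_abs_self y) hx0
    have h2 : |y| * x ≤ |y| * t := mul_le_mul_of_nonneg_left hxt (abs_nonneg y)
    simp only
    linarith
  · refine le_max_of_le_right ?_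
    have h1 := (hg.convexOn_axisCost i).le_slope_of_hasDerivWithinAt ht0 hx0 hxt
      (hg.hasDerivWithinAt_axisCost i ht0)
    have h2 := hty.trans h1
    rw [slope_def_field, le_div_iff₀ (sub_pos.2 hxt)] at h2
    change y * x - axisCost g i x ≤ y * t
    linarith

theorem NiceCost.le_marginalDual (hg : NiceCost g) (i : Fin d) (y : ℝ) {x : ℝ} (hx : 0 ≤ x) :
    y * x - axisCost g i x ≤ marginalDual g i y :=
  le_csSup (hg.bddAbove_dual i y) ⟨x, hx, rfl⟩

theorem marginalDual_le {i : Fin d} {y c : ℝ} (h : ∀ x, 0 ≤ x → y * x - axisCost g i x ≤ c) :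
    marginalDual g i y ≤ c := by
  refine csSup_le (nonempty_Ici.image _) ?_
  rintro _ ⟨x, hx, rfl⟩
  exact h x hx

/-- A pointwise supremum of functions affine in `y`. Semicontinuity is all that is needed to obtain
a last balance time on the curve. -/
theorem NiceCost.lowerSemicontinuous_marginalDual (hg : NiceCost g) (i : Fin d) :
    LowerSemicontinuous (marginalDual g i) := by
  intro y a ha
  obtain ⟨_, ⟨x, hx, rfl⟩, hax⟩ := exists_lt_of_lt_csSup (nonempty_Ici.image _) ha
  have hc : Continuous fun y' : ℝ => y' * x - g (Pi.single i x) := by fun_prop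
  filter_upwards [hc.continuousAt.eventually (lt_mem_nhds hax)] with y' hy'
  exact hy'.trans_le (hg.le_marginalDual i y' hx)

theorem NiceCost.concaveOn_gain (hg : NiceCost g) (i : Fin d) (y : ℝ) :
    ConcaveOn ℝ (Ici 0) fun x => y * x - axisCost g i x := by
  have h1 : ConcaveOn ℝ (Ici (0 : ℝ)) fun x : ℝ => y * x := by
    refine ⟨convex_Ici 0, fun a _ b _ p q _ _ _ => le_of_eq ?_⟩
    simp only [smul_eq_mul]
    ring
  exact h1.sub (hg.convexOn_axisCost i)

end Cost

/-! ### Submodularity -/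

/-- The points `a` and `b` are complementary convex combinations of `p` and `q`, with weights `1 -
t, t` and `t, 1 - t`. -/
theorem add_le_add_of_concaveOn {φ : ℝ → ℝ} (hφ : ConcaveOn ℝ (Ici 0) φ) {p a b q : ℝ}
    (hp : 0 ≤ p) (hpa : p ≤ a) (haq : a ≤ q) (hsum : p + q = a + b) :
    φ p + φ q ≤ φ a + φ b := by
  rcases hpa.eq_or_lt with rfl | hpa
  · have : q = b := by linarith
    rw [this]
  have hpq : 0 < q - p := by linarith
  set t := (a - p) / (q - p) with ht
  have ht0 : 0 ≤ t := div_nonneg (by linarith) hpq.le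
  have ht1 : 0 ≤ 1 - t := by
    rw [ht, sub_nonneg, div_le_one hpq]
    linarith
  have hmul : t * (q - p) = a - p := div_mul_cancel₀ _ hpq.ne'
  have hq : 0 ≤ q := by linarith
  have h1 := hφ.2 (x := p) (y := q) hp hq ht1 ht0 (by ring)
  have h2 := hφ.2 (x := p) (y := q) hp hq ht0 ht1 (by ring)
  simp only [smul_eq_mul] at h1 h2
  have e1 : (1 - t) * p + t * q = a := by linarith
  have e2 : t * p + (1 - t) * q = b := by linarith
  rw [e1] at h1
  rw [e2] at h2
  linarith

section Submodular

variable {U : Type u} [DecidableEq U]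

/-- A concave function of a nonnegative additive function is submodular; monotonicity of `φ` is not
needed. It is applied both to `-g_i` and to truncated gains. -/
theorem sum_union_add_sum_inter {d : ℕ} {w : U → ℝ} {a : U → Fin d → ℝ} {φ : Fin d → ℝ → ℝ}
    (ha : ∀ e i, 0 ≤ a e i) (hφ : ∀ i, ConcaveOn ℝ (Ici 0) (φ i)) (A B : Finset U) :
    (∑ e ∈ A ∪ B, w e + ∑ i, φ i (∑ e ∈ A ∪ B, a e i)) +
        (∑ e ∈ A ∩ B, w e + ∑ i, φ i (∑ e ∈ A ∩ B, a e i)) ≤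
      (∑ e ∈ A, w e + ∑ i, φ i (∑ e ∈ A, a e i)) +
        (∑ e ∈ B, w e + ∑ i, φ i (∑ e ∈ B, a e i)) := by
  have h1 := Finset.sum_union_inter (s₁ := A) (s₂ := B) (f := w)
  have h2 : ∑ i, (φ i (∑ e ∈ A ∩ B, a e i) + φ i (∑ e ∈ A ∪ B, a e i)) ≤
      ∑ i, (φ i (∑ e ∈ A, a e i) + φ i (∑ e ∈ B, a e i)) := by
    refine Finset.sum_le_sum fun i _ => add_le_add_of_concaveOn (hφ i)
      (Finset.sum_nonneg fun e _ => ha e i) ?_ ?_ ?_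
    · exact Finset.sum_le_sum_of_subset_of_nonneg Finset.inter_subset_left fun e _ _ => ha e i
    · exact Finset.sum_le_sum_of_subset_of_nonneg Finset.subset_union_left fun e _ _ => ha e i
    · rw [add_comm, Finset.sum_union_inter (s₁ := A) (s₂ := B) (f := fun e => a e i)]
  simp only [Finset.sum_add_distrib] at h2
  linarith

/-- A monotone submodular function dominates a nonnegative modular function with the same value on
the whole set. -/
theorem MonotoneSubmodular.exists_weights {f : Finset U → ℝ} (hf : MonotoneSubmodular f)
    (A : Finset U) :
    ∃ w : U → ℝ, (∀ e, 0 ≤ w e) ∧ ∑ e ∈ A, w e = f A ∧ (∀ e ∈ A, w e ≤ f {e}) ∧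
      ∀ S ⊆ A, ∑ e ∈ S, w e ≤ f S := by
  -- The weights are the marginal values in the order of insertion.
  induction A using Finset.induction_on with
  | empty =>
    refine ⟨fun _ => 0, fun _ => le_rfl, by simp [hf.map_empty], by simp, fun S _ => ?_⟩
    simpa using hf.nonneg S
  | insert a A ha ih =>
    obtain ⟨w, hw0, hwA, hw1, hwS⟩ := ih
    have hne : ∀ e ∈ A, e ≠ a := fun e he h => ha (h ▸ he)
    have hcongr : ∀ S ⊆ A, ∑ e ∈ S, Function.update w a (f (insert a A) - f A) e
        = ∑ e ∈ S, w e := fun S hS =>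
      Finset.sum_congr rfl fun e he => Function.update_of_ne (hne e (hS he)) _ _
    refine ⟨Function.update w a (f (insert a A) - f A), fun e => ?_, ?_, fun e he => ?_,
      fun S hS => ?_⟩
    · rcases eq_or_ne e a with rfl | h
      · simpa using hf.mono _ _ (Finset.subset_insert _ _)
      · simpa [h] using hw0 e
    · rw [Finset.sum_insert ha, hcongr A subset_rfl, hwA]
      simp
    · rcases eq_or_ne e a with rfl | h
      · have h1 := hf.submodular {e} A
        rw [Finset.singleton_inter_of_notMem ha, hf.map_empty] at h1
        rw [Function.update_self, Finset.insert_eq]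
        linarith
      · rw [Function.update_of_ne h]
        exact hw1 e (Finset.mem_of_mem_insert_of_ne he h)
    · by_cases haS : a ∈ S
      · have hSA : S.erase a ⊆ A := Finset.subset_insert_iff.1 hS
        have h1 := hf.submodular S A
        have h2 : S ∪ A = insert a A := by
          ext x
          have := @hS x
          simp only [Finset.mem_union, Finset.mem_insert] at this ⊢
          constructor
          · rintro (h | h)
            exacts [this h, Or.inr h]
          · rintro (rfl | h)
            exacts [Or.inl haS, Or.inr h]
        have h3 : S ∩ A = S.erase a := by
          ext x
          have := @hS x
          have := hne x
          simp only [Finset.mem_inter, Finset.mem_erase, Finset.mem_insert] at *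
          tauto
        rw [h2, h3] at h1
        have h4 := hwS _ hSA
        rw [← Finset.add_sum_erase _ _ haS, Function.update_self, hcongr _ hSA]
        linarith
      · have hSA : S ⊆ A := fun x hx =>
          Finset.mem_of_mem_insert_of_ne (hS hx) fun h => haS (h ▸ hx)
        rw [hcongr S hSA]
        exact hwS S hSA

end Submodular

/-! ### Concentration of the weight of a random subset -/

section Concentration

variable {U : Type u} [DecidableEq U]

/-- The variance of a sum of independent fair coins with weights `w`: deciding about a new element
shifts the deviation by `± w a / 2`, and the cross terms cancel. -/
theorem sum_powerset_sq_sub_half (w : U → ℝ) (A : Finset U) :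
    ∑ S ∈ A.powerset, (∑ e ∈ S, w e - (∑ e ∈ A, w e) / 2) ^ 2 =
      2 ^ A.card * ((∑ e ∈ A, w e ^ 2) / 4) := by
  induction A using Finset.induction_on with
  | empty => simp
  | insert a A ha ih =>
    rw [Finset.sum_powerset_insert ha, Finset.card_insert_of_notMem ha, Finset.sum_insert ha,
      Finset.sum_insert ha, ← Finset.sum_add_distrib]
    have h : ∀ S ∈ A.powerset, (∑ e ∈ S, w e - (w a + ∑ e ∈ A, w e) / 2) ^ 2 +
        (∑ e ∈ insert a S, w e - (w a + ∑ e ∈ A, w e) / 2) ^ 2 =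
        2 * (∑ e ∈ S, w e - (∑ e ∈ A, w e) / 2) ^ 2 + w a ^ 2 / 2 := by
      intro S hS
      rw [Finset.sum_insert fun h => ha (Finset.mem_powerset.1 hS h)]
      ring
    rw [Finset.sum_congr rfl h, Finset.sum_add_distrib, ← Finset.mul_sum, ih]
    simp only [Finset.sum_const, Finset.card_powerset, nsmul_eq_mul]
    push_cast
    ring

/-- Chebyshev's inequality for the weight of a uniformly random subset. -/
theorem card_deviation_mul_le [Fintype U] {w : U → ℝ} {M W : ℝ} (hw0 : ∀ e, 0 ≤ w e)
    (hwM : ∀ e, w e ≤ M) (hW : ∑ e, w e = W) (hWpos : 0 < W) :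
    4 * W * ((Finset.univ.filter fun S : Finset U =>
      ∑ e ∈ S, w e < W / 6 ∨ ∑ e ∈ Sᶜ, w e < W / 6).card : ℝ) ≤
      9 * M * 2 ^ Fintype.card U := by
  classical
  have h1 := sum_powerset_sq_sub_half w (Finset.univ : Finset U)
  rw [Finset.powerset_univ, hW, Finset.card_univ] at h1
  have h2 : ∑ e, w e ^ 2 ≤ M * W := by
    rw [← hW, Finset.mul_sum]
    refine Finset.sum_le_sum fun e _ => ?_
    rw [sq]
    exact mul_le_mul_of_nonneg_right (hwM e) (hw0 e)
  set D := Finset.univ.filter fun S : Finset U =>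
      ∑ e ∈ S, w e < W / 6 ∨ ∑ e ∈ Sᶜ, w e < W / 6 with hD
  -- A weight below `W / 6`, of `S` or of its complement, puts the weight of `S` at distance more
  -- than `W / 3` from the mean `W / 2`.
  have h3 : (D.card : ℝ) * (W ^ 2 / 9) ≤ ∑ S : Finset U, (∑ e ∈ S, w e - W / 2) ^ 2 := by
    calc (D.card : ℝ) * (W ^ 2 / 9) = ∑ S ∈ D, W ^ 2 / 9 := by simp
      _ ≤ ∑ S ∈ D, (∑ e ∈ S, w e - W / 2) ^ 2 := by
        refine Finset.sum_le_sum fun S hS => ?_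
        have hc := Finset.sum_add_sum_compl S w
        rw [hW] at hc
        rcases (Finset.mem_filter.1 hS).2 with h | h
        · nlinarith
        · nlinarith
      _ ≤ _ := Finset.sum_le_sum_of_subset_of_nonneg (Finset.subset_univ _)
        fun _ _ _ => sq_nonneg _
  have h4 : (D.card : ℝ) * (W ^ 2 / 9) ≤ 2 ^ Fintype.card U * (M * W / 4) := by
    rw [h1] at h3
    refine h3.trans (mul_le_mul_of_nonneg_left ?_ (by positivity))
    linarith
  have h5 : W * (4 * W * D.card) ≤ W * (9 * M * 2 ^ Fintype.card U) := by nlinarith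
  exact le_of_mul_le_mul_left h5 hWpos

end Concentration

/-! ### Fractional solutions -/

namespace Instance

section Hull

variable {d : ℕ} {U : Type u} [Fintype U] (I : Instance d U)

/-- The fractional solutions supported on `A`. -/
def hull (A : Finset U) : Set (U → ℝ) :=
  convexHull ℝ ((fun X : Finset U => Set.indicator (X : Set U) (fun _ => (1 : ℝ))) ''
      {X | X ∈ I.feasible ∧ X ⊆ A})

variable {I} {A B : Finset U} {y : U → ℝ}

theorem sum_mul_indicator (A : Finset U) (w y : U → ℝ) :
    ∑ e, w e * Set.indicator (A : Set U) y e = ∑ e ∈ A, w e * y e := by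
  classical
  simp only [Set.indicator_apply, Finset.mem_coe, mul_ite, mul_zero, Finset.sum_ite_mem,
    Finset.univ_inter]

theorem indicator_mem_hull {X : Finset U} (hX : X ∈ I.feasible) (hXA : X ⊆ A) :
    Set.indicator (X : Set U) (fun _ => (1 : ℝ)) ∈ I.hull A :=
  subset_convexHull _ _ ⟨X, ⟨hX, hXA⟩, rfl⟩

/-- A linear functional on the hull is bounded by its values at the vertices. Signed unit vectors as
`w` give the coordinatewise bounds, sizes as `w` give the volume bounds. -/
theorem sum_mul_le_of_mem_hull {w : U → ℝ} {c : ℝ}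
    (h : ∀ X ∈ I.feasible, X ⊆ A → ∑ e ∈ X, w e ≤ c) (hy : y ∈ I.hull A) :
    ∑ e, w e * y e ≤ c := by
  have hlin : IsLinearMap ℝ fun y : U → ℝ => ∑ e, w e * y e :=
    ⟨fun x y => by simp [mul_add, Finset.sum_add_distrib],
      fun a x => by simp only [Pi.smul_apply, smul_eq_mul, Finset.mul_sum]; congr! 1; ring⟩
  refine convexHull_min ?_ (convex_halfSpace_le hlin c) hy
  rintro _ ⟨X, ⟨hX, hXA⟩, rfl⟩
  simpa [sum_mul_indicator] using h X hX hXA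

theorem nonneg_of_mem_hull (hy : y ∈ I.hull A) (e : U) : 0 ≤ y e := by
  classical
  have h := sum_mul_le_of_mem_hull (w := Pi.single e (-1)) (c := 0) (fun X _ _ => by
    refine Finset.sum_nonpos fun a _ => ?_
    rcases eq_or_ne a e with rfl | hae <;> simp [*]) hy
  simpa [Pi.single_apply] using h

theorem le_one_of_mem_hull (hy : y ∈ I.hull A) (e : U) : y e ≤ 1 := by
  classical
  have h := sum_mul_le_of_mem_hull (w := Pi.single e 1) (c := 1) (fun X _ _ => by
    simp only [Pi.single_apply, Finset.sum_ite_eq']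
    split_ifs <;> simp) hy
  simpa [Pi.single_apply] using h

theorem eq_zero_of_mem_hull (hy : y ∈ I.hull A) {e : U} (he : e ∉ A) : y e = 0 := by
  classical
  have h := sum_mul_le_of_mem_hull (w := Pi.single e 1) (c := 0) (fun X _ hX => by
    simp only [Pi.single_apply, Finset.sum_ite_eq']
    rw [if_neg fun h => he (hX h)]) hy
  refine le_antisymm ?_ (nonneg_of_mem_hull hy e)
  simpa [Pi.single_apply] using h

theorem hull_mono (h : A ⊆ B) : I.hull A ⊆ I.hull B :=
  convexHull_mono (Set.image_mono fun _ hX => ⟨hX.1, hX.2.trans h⟩)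

/-- Zeroing coordinates is linear and sends the vertex of `X` to that of `B ∩ X`, which is feasible
by downward closure. -/
theorem WellFormed.indicator_mem_hull_inter [DecidableEq U] (hI : I.WellFormed)
    (hy : y ∈ I.hull A) (B : Finset U) : Set.indicator (B : Set U) y ∈ I.hull (A ∩ B) := by
  have hlin : IsLinearMap ℝ fun y : U → ℝ => Set.indicator (B : Set U) y :=
    ⟨fun x y => Set.indicator_add _ _ _, fun a x => Set.indicator_const_smul _ a x⟩
  refine convexHull_min (t := (fun y => Set.indicator (B : Set U) y) ⁻¹' I.hull (A ∩ B)) ?_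
    ((convex_convexHull ℝ _).is_linear_preimage hlin) hy
  rintro _ ⟨X, ⟨hX, hXA⟩, rfl⟩
  have h := indicator_mem_hull (I := I) (A := A ∩ B) (X := B ∩ X)
    (hI.down_closed X hX _ Finset.inter_subset_right)
    (by rw [Finset.inter_comm]; exact Finset.inter_subset_inter_right hXA)
  simpa [Set.indicator_indicator] using h

theorem WellFormed.zero_mem_hull (hI : I.WellFormed) (A : Finset U) : 0 ∈ I.hull A := by
  have h := indicator_mem_hull (A := A) hI.empty_feasible (Finset.empty_subset _)
  rwa [Finset.coe_empty, Set.indicator_empty'] at h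

theorem isCompact_hull (A : Finset U) : IsCompact (I.hull A) :=
  ((Set.toFinite _).image _).isCompact_convexHull ℝ

theorem sum_smul_size_mem_orthant (hI : I.WellFormed) (hy : ∀ e, 0 ≤ y e) :
    (∑ e, y e • I.size e) ∈ orthant d :=
  Finset.sum_nonneg fun e _ => smul_nonneg (hy e) (hI.size_nonneg e)

theorem fracProfit_indicator_one (X : Finset U) :
    I.fracProfit (Set.indicator (X : Set U) fun _ => 1) = I.profit X := by
  classical
  simp [fracProfit, profit, Set.indicator_apply]

theorem continuousOn_fracProfit (hI : I.WellFormed) (hg : NiceCost I.cost) :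
    ContinuousOn I.fracProfit {y | ∀ e, 0 ≤ y e} := by
  refine ContinuousOn.sub (by fun_prop) ?_
  exact hg.differentiable.continuousOn.comp (by fun_prop) fun y hy => sum_smul_size_mem_orthant hI hy

theorem exists_isMaxOn_hull (hI : I.WellFormed) (hg : NiceCost I.cost) (A : Finset U) :
    ∃ y ∈ I.hull A, IsMaxOn I.fracProfit (I.hull A) y :=
  (isCompact_hull A).exists_isMaxOn ⟨0, hI.zero_mem_hull A⟩
    ((continuousOn_fracProfit hI hg).mono fun _ hy => nonneg_of_mem_hull hy)

theorem exists_fracProfit_eq_fopt (hI : I.WellFormed) (hg : NiceCost I.cost) (A : Finset U) :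
    ∃ y ∈ I.hull A, I.fracProfit y = I.fopt A ∧ ∀ z ∈ I.hull A, I.fracProfit z ≤ I.fopt A := by
  obtain ⟨y, hy, hmax⟩ := exists_isMaxOn_hull hI hg A
  have h : I.fopt A = I.fracProfit y := by
    refine IsGreatest.csSup_eq ⟨⟨y, hy, rfl⟩, ?_⟩
    rintro _ ⟨z, hz, rfl⟩
    exact hmax hz
  exact ⟨y, hy, h.symm, fun z hz => h ▸ hmax hz⟩

theorem fracProfit_le_fopt (hI : I.WellFormed) (hg : NiceCost I.cost) (hy : y ∈ I.hull A) :
    I.fracProfit y ≤ I.fopt A :=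
  (exists_fracProfit_eq_fopt hI hg A).choose_spec.2.2 y hy

theorem fopt_le {c : ℝ} (hI : I.WellFormed) (h : ∀ y ∈ I.hull A, I.fracProfit y ≤ c) :
    I.fopt A ≤ c := by
  refine csSup_le (Set.Nonempty.image _ ⟨0, hI.zero_mem_hull A⟩) ?_
  rintro _ ⟨y, hy, rfl⟩
  exact h y hy

theorem fracProfit_zero (hg : NiceCost I.cost) : I.fracProfit 0 = 0 := by
  simp [fracProfit, hg.map_zero]

theorem fopt_nonneg (hI : I.WellFormed) (hg : NiceCost I.cost) (A : Finset U) : 0 ≤ I.fopt A :=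
  fracProfit_zero hg ▸ fracProfit_le_fopt hI hg (hI.zero_mem_hull A)

theorem fopt_mono (hI : I.WellFormed) (hg : NiceCost I.cost) (h : A ⊆ B) :
    I.fopt A ≤ I.fopt B :=
  fopt_le hI fun _ hy => fracProfit_le_fopt hI hg (hull_mono h hy)

theorem fopt_empty (hI : I.WellFormed) (hg : NiceCost I.cost) : I.fopt ∅ = 0 := by
  refine le_antisymm (fopt_le hI fun y hy => ?_) (fopt_nonneg hI hg _)
  have : y = 0 := funext fun e => eq_zero_of_mem_hull hy (Finset.notMem_empty e)
  rw [this, fracProfit_zero hg]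

theorem profit_le_opt {X : Finset U} (hX : X ∈ I.feasible) (hXA : X ⊆ A) :
    I.profit X ≤ I.opt A :=
  le_csSup ((Set.toFinite _).image _).bddAbove ⟨X, ⟨hX, hXA⟩, rfl⟩

theorem opt_nonneg (hI : I.WellFormed) (hg : NiceCost I.cost) (A : Finset U) : 0 ≤ I.opt A := by
  have h := profit_le_opt (A := A) hI.empty_feasible (Finset.empty_subset _)
  simpa [profit, hg.map_zero] using h

theorem exists_profit_eq_opt (hI : I.WellFormed) (A : Finset U) :
    ∃ X ∈ I.feasible, X ⊆ A ∧ I.profit X = I.opt A := by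
  have hne : (I.profit '' {X | X ∈ I.feasible ∧ X ⊆ A}).Nonempty :=
    ⟨_, ∅, ⟨hI.empty_feasible, Finset.empty_subset _⟩, rfl⟩
  obtain ⟨X, ⟨hX, hXA⟩, h⟩ := hne.csSup_mem ((Set.toFinite _).image _)
  exact ⟨X, hX, hXA, h⟩

theorem opt_le_fopt (hI : I.WellFormed) (hg : NiceCost I.cost) (A : Finset U) :
    I.opt A ≤ I.fopt A := by
  obtain ⟨X, hX, hXA, h⟩ := exists_profit_eq_opt hI A
  rw [← h, ← fracProfit_indicator_one]
  exact fracProfit_le_fopt hI hg (indicator_mem_hull hX hXA)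

/-- The profit in terms of reduced values `v(e) - ⟨μ, s(e)⟩` and coordinatewise gains. -/
theorem fracProfit_eq_gain (hI : I.WellFormed) (hg : NiceCost I.cost) (hs : Separable I.cost)
    (μ : Fin d → ℝ) (hy : ∀ e, 0 ≤ y e) :
    I.fracProfit y = ∑ e, (I.value e - I.load μ e) * y e +
      ∑ i, (μ i * (∑ e, y e * I.size e i) - axisCost I.cost i (∑ e, y e * I.size e i)) := by
  rw [fracProfit, hs.eq_sum_axisCost hg.map_zero (sum_smul_size_mem_orthant hI hy)]
  simp only [Finset.sum_apply, Pi.smul_apply, smul_eq_mul, sub_mul, Finset.sum_sub_distrib]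
  have h : ∑ e, I.load μ e * y e = ∑ i, μ i * ∑ e, y e * I.size e i := by
    simp only [load, Finset.sum_mul, Finset.mul_sum]
    rw [Finset.sum_comm]
    refine Finset.sum_congr rfl fun i _ => Finset.sum_congr rfl fun e _ => ?_
    ring
  rw [h]
  ring

theorem profit_eq_gain (hI : I.WellFormed) (hg : NiceCost I.cost) (hs : Separable I.cost)
    (μ : Fin d → ℝ) (X : Finset U) :
    I.profit X = ∑ e ∈ X, (I.value e - I.load μ e) +
      ∑ i, (μ i * (∑ e ∈ X, I.size e i) - axisCost I.cost i (∑ e ∈ X, I.size e i)) := by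
  classical
  rw [← fracProfit_indicator_one, fracProfit_eq_gain hI hg hs μ
    (fun e => Set.indicator_nonneg (fun _ _ => zero_le_one) e)]
  have h : ∀ i, ∑ e, Set.indicator (X : Set U) (fun _ => (1 : ℝ)) e * I.size e i =
      ∑ e ∈ X, I.size e i := fun i => by simp [Set.indicator_apply]
  simp only [h, sum_mul_indicator, mul_one]

/-! ### Restrictions of a fractional solution: submodularity and random sampling. -/

theorem fracProfit_indicator (hI : I.WellFormed) (hg : NiceCost I.cost) (hs : Separable I.cost)
    (hy : ∀ e, 0 ≤ y e) (A : Finset U) :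
    I.fracProfit (Set.indicator (A : Set U) y) = ∑ e ∈ A, I.value e * y e +
      ∑ i, -axisCost I.cost i (∑ e ∈ A, y e * I.size e i) := by
  classical
  rw [fracProfit_eq_gain hI hg hs 0 (fun e => Set.indicator_nonneg (fun e _ => hy e) e)]
  have h : ∀ i, ∑ e, Set.indicator (A : Set U) y e * I.size e i =
      ∑ e ∈ A, y e * I.size e i := fun i => by simp [Set.indicator_apply]
  have hl : ∀ e, I.load 0 e = 0 := fun e => by simp [load]
  simp only [h, sum_mul_indicator, hl, sub_zero, Pi.zero_apply, zero_mul, zero_sub]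

theorem fracProfit_indicator_submodular [DecidableEq U] (hI : I.WellFormed)
    (hg : NiceCost I.cost) (hs : Separable I.cost) (hy : ∀ e, 0 ≤ y e) (A B : Finset U) :
    I.fracProfit (Set.indicator ((A ∪ B : Finset U) : Set U) y) +
        I.fracProfit (Set.indicator ((A ∩ B : Finset U) : Set U) y) ≤
      I.fracProfit (Set.indicator (A : Set U) y) + I.fracProfit (Set.indicator (B : Set U) y) := by
  simp only [fracProfit_indicator hI hg hs hy]
  exact sum_union_add_sum_inter (fun e i => mul_nonneg (hy e) (hI.size_nonneg e i))
    (fun i => (hg.convexOn_axisCost i).neg) A B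

/-- An optimal fractional solution has a nonnegative monotone submodular profit function. -/
theorem monotoneSubmodular_of_isMax [DecidableEq U] (hI : I.WellFormed) (hg : NiceCost I.cost)
    (hs : Separable I.cost) (hy : y ∈ I.hull A) (hmax : I.fracProfit y = I.fopt A) :
    MonotoneSubmodular fun S : Finset U => I.fracProfit (Set.indicator (S : Set U) y) := by
  have hsub := fracProfit_indicator_submodular hI hg hs (nonneg_of_mem_hull hy)
  have hmono : ∀ S T : Finset U, S ⊆ T → I.fracProfit (Set.indicator (S : Set U) y) ≤
      I.fracProfit (Set.indicator (T : Set U) y) := by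
    intro S T hST
    -- Monotonicity comes from optimality: if deleting `T \ S` raised the profit inside `T`, then by
    -- submodularity it would raise the profit of `y` itself, although the truncated vector stays in
    -- the hull.
    have h := hsub T (Finset.univ \ (T \ S))
    have h1 : T ∪ Finset.univ \ (T \ S) = Finset.univ := by
      ext e; simp only [Finset.mem_union, Finset.mem_sdiff, Finset.mem_univ]; tauto
    have h2 : T ∩ (Finset.univ \ (T \ S)) = S := by
      ext e
      have := @hST e
      simp only [Finset.mem_inter, Finset.mem_sdiff, Finset.mem_univ]; tauto
    rw [h1, h2, Finset.coe_univ, Set.indicator_univ, hmax] at h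
    have h3 := fracProfit_le_fopt hI hg (hull_mono Finset.inter_subset_left
      (hI.indicator_mem_hull_inter hy (Finset.univ \ (T \ S))))
    linarith
  have h0 : I.fracProfit (Set.indicator ((∅ : Finset U) : Set U) y) = 0 := by
    rw [Finset.coe_empty, Set.indicator_empty', fracProfit_zero hg]
  exact ⟨fun S => h0 ▸ hmono ∅ S (Finset.empty_subset _), hmono, hsub, h0⟩

/-- With `M` bounding the profit of every fraction of a single item, most random subsets retain a
sixth of the fractional optimum, and so do their complements. -/
theorem card_fopt_deviation_mul_le [DecidableEq U] (hI : I.WellFormed) (hg : NiceCost I.cost)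
    (hs : Separable I.cost) {M : ℝ}
    (hM : ∀ e, ∀ t ∈ Icc (0 : ℝ) 1, t * I.value e - I.cost (t • I.size e) ≤ M)
    (A : Finset U) (hA : 0 < I.fopt A) :
    4 * I.fopt A * ((Finset.univ.filter fun S : Finset U =>
      I.fopt (A ∩ S) < I.fopt A / 6 ∨ I.fopt (A ∩ Sᶜ) < I.fopt A / 6).card : ℝ) ≤
      9 * M * 2 ^ Fintype.card U := by
  obtain ⟨y, hy, hyA, hle⟩ := exists_fracProfit_eq_fopt hI hg A
  obtain ⟨w, hw0, hwA, hw1, hwS⟩ :=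
    (monotoneSubmodular_of_isMax hI hg hs hy hyA).exists_weights Finset.univ
  have hwM : ∀ e, w e ≤ M := by
    intro e
    refine (hw1 e (Finset.mem_univ e)).trans (le_trans (le_of_eq ?_)
      (hM e (y e) ⟨nonneg_of_mem_hull hy e, le_one_of_mem_hull hy e⟩))
    simp [fracProfit, Set.indicator_apply, mul_comm]
  -- The additive weights of `S` are certified by restricting `y` to `S`, so concentration for the
  -- weights transfers to `fopt`.
  have hfopt : ∀ S : Finset U, ∑ e ∈ S, w e ≤ I.fopt (A ∩ S) := fun S =>
    (hwS S (Finset.subset_univ S)).trans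
      (fracProfit_le_fopt hI hg (hI.indicator_mem_hull_inter hy S))
  have hsum : ∑ e, w e = I.fopt A := by simpa [hyA] using hwA
  refine le_trans ?_ (card_deviation_mul_le hw0 hwM hsum hA)
  have h4 : (0 : ℝ) ≤ 4 * I.fopt A := by positivity
  refine mul_le_mul_of_nonneg_left (Nat.cast_le.2 (Finset.card_le_card fun S hS => ?_)) h4
  rw [Finset.mem_filter] at hS ⊢
  exact ⟨hS.1, hS.2.imp (hfopt S).trans_lt (hfopt Sᶜ).trans_lt⟩

/-- Adding one item raises the fractional optimum by at most its profit. -/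
theorem fopt_insert_le [DecidableEq U] (hI : I.WellFormed) (hg : NiceCost I.cost)
    (hs : Separable I.cost) {M : ℝ}
    (hM : ∀ e, ∀ t ∈ Icc (0 : ℝ) 1, t * I.value e - I.cost (t • I.size e) ≤ M)
    (A : Finset U) (a : U) : I.fopt (insert a A) ≤ I.fopt A + M := by
  by_cases ha : a ∈ A
  · rw [Finset.insert_eq_of_mem ha]
    have := hM a 0 (by simp)
    simp only [zero_mul, zero_smul, hg.map_zero, sub_zero] at this
    linarith
  refine fopt_le hI fun y hy => ?_
  have hy0 := nonneg_of_mem_hull hy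
  -- Since `A` and `{a}` are disjoint, submodularity is subadditivity here: `y` splits into its part
  -- on `A` and a fraction of `a`.
  have h := fracProfit_indicator_submodular hI hg hs hy0 A {a}
  have h1 : Set.indicator ((A ∪ {a} : Finset U) : Set U) y = y := by
    rw [Set.indicator_eq_self]
    intro e he
    by_contra hne
    refine he (eq_zero_of_mem_hull hy fun h => hne ?_)
    simpa [or_comm] using h
  have h2 : I.fracProfit (Set.indicator ((A ∩ {a} : Finset U) : Set U) y) = 0 := by
    rw [Finset.inter_singleton_of_notMem ha, Finset.coe_empty, Set.indicator_empty',
      fracProfit_zero hg]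
  have h3 : I.fracProfit (Set.indicator (({a} : Finset U) : Set U) y) ≤ M := by
    refine le_trans (le_of_eq ?_) (hM a (y a) ⟨hy0 a, le_one_of_mem_hull hy a⟩)
    simp [fracProfit, Set.indicator_apply, mul_comm]
  have h4 := fracProfit_le_fopt hI hg (hull_mono (Finset.inter_subset_right)
    (hI.indicator_mem_hull_inter hy A))
  rw [h1, h2] at h
  linarith

/-- Without exceptional items a fraction of an item is no better than nothing or all of it. -/
theorem fraction_le_of_not_exceptional (hI : I.WellFormed) (hg : NiceCost I.cost) {e : U}
    (he : ¬ I.Exceptional e) {M : ℝ} (hM0 : 0 ≤ M) (hM : I.profit {e} ≤ M) :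
    ∀ t ∈ Icc (0 : ℝ) 1, t * I.value e - I.cost (t • I.size e) ≤ M := by
  intro t ht
  have hcont : ContinuousOn (fun t : ℝ => t * I.value e - I.cost (t • I.size e)) (Icc 0 1) := by
    refine ContinuousOn.sub (by fun_prop) ?_
    exact hg.differentiable.continuousOn.comp (by fun_prop)
      fun t ht => smul_nonneg ht.1 (hI.size_nonneg e)
  obtain ⟨θ, hθ, hmax⟩ := isCompact_Icc.exists_isMaxOn (nonempty_Icc.2 zero_le_one) hcont
  refine (hmax ht).trans ?_
  rcases hθ.1.eq_or_lt with rfl | h0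
  · simpa [hg.map_zero] using hM0
  rcases hθ.2.eq_or_lt with rfl | h1
  · simpa [profit] using hM
  · exact absurd ⟨θ, ⟨h0, h1⟩, hmax⟩ he

end Hull

end Instance

/-! ### Classifiers -/

namespace Instance

section Classifier

variable {d : ℕ} {U : Type u} [Fintype U] {I : Instance d U} {A B R X : Finset U}
  {μ : Fin d → ℝ}

open Classical in
/-- The items of `A` with `v(e) > ⟨lam, s(e)⟩`. -/
def strictPicked (I : Instance d U) (A : Finset U) (lam : Fin d → ℝ) : Finset U :=
  A.filter fun e => I.load lam e < I.value e

theorem mem_picked {e : U} : e ∈ I.picked A μ ↔ e ∈ A ∧ I.load μ e ≤ I.value e := by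
  simp [picked]

theorem mem_strictPicked {e : U} : e ∈ I.strictPicked A μ ↔ e ∈ A ∧ I.load μ e < I.value e := by
  simp [strictPicked]

theorem strictPicked_subset_picked : I.strictPicked A μ ⊆ I.picked A μ := fun _ he =>
  mem_picked.2 ((mem_strictPicked.1 he).imp_right le_of_lt)

theorem load_mono (hI : I.WellFormed) {μ ν : Fin d → ℝ} (h : μ ≤ ν) (e : U) :
    I.load μ e ≤ I.load ν e :=
  Finset.sum_le_sum fun i _ => mul_le_mul_of_nonneg_right (h i) (hI.size_nonneg e i)

theorem picked_subset_picked (hI : I.WellFormed) (hAB : A ⊆ B) {μ ν : Fin d → ℝ} (h : μ ≤ ν) :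
    I.picked A ν ⊆ I.picked B μ := fun e he => by
  rw [mem_picked] at he ⊢
  exact ⟨hAB he.1, (load_mono hI h e).trans he.2⟩

/-- No coordinate of the size of `X` exceeds the point up to which adding volume at the price `μ`
pays off. -/
def NoOverflow (I : Instance d U) (μ : Fin d → ℝ) (X : Finset U) : Prop :=
  ∀ i x, 0 ≤ x → x ≤ ∑ e ∈ X, I.size e i →
    μ i * x - axisCost I.cost i x ≤
      μ i * (∑ e ∈ X, I.size e i) - axisCost I.cost i (∑ e ∈ X, I.size e i)

theorem sum_size_nonneg (hI : I.WellFormed) (X : Finset U) (i : Fin d) :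
    0 ≤ ∑ e ∈ X, I.size e i :=
  Finset.sum_nonneg fun e _ => hI.size_nonneg e i

/-- A concave function vanishing at 0 and nonnegative at `q` is nonnegative in between. -/
theorem gain_nonneg (hg : NiceCost I.cost) {i : Fin d} {y x q : ℝ} (hx : 0 ≤ x) (hxq : x ≤ q)
    (hq : 0 ≤ y * q - axisCost I.cost i q) : 0 ≤ y * x - axisCost I.cost i x := by
  have h := (hg.concaveOn_gain i y).min_le_of_mem_Icc (x := 0) (y := q) (z := x)
    self_mem_Ici (hx.trans hxq) ⟨hx, hxq⟩
  simp only [mul_zero, hg.axisCost_zero, sub_zero] at h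
  rwa [min_eq_left hq] at h

theorem NoOverflow.gain_nonneg (hI : I.WellFormed) (hg : NiceCost I.cost)
    (hX : I.NoOverflow μ X) (i : Fin d) {x : ℝ} (hx : 0 ≤ x) (hxX : x ≤ ∑ e ∈ X, I.size e i) :
    0 ≤ μ i * x - axisCost I.cost i x := by
  refine Instance.gain_nonneg hg hx hxX ?_
  have h := hX i 0 le_rfl (sum_size_nonneg hI X i)
  simpa [hg.axisCost_zero] using h

theorem smul_indicator_mem_hull (hI : I.WellFormed) (hX : X ∈ I.feasible) (hXA : X ⊆ A) {t : ℝ}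
    (ht0 : 0 ≤ t) (ht1 : t ≤ 1) :
    t • Set.indicator (X : Set U) (fun _ => (1 : ℝ)) ∈ I.hull A :=
  (convex_convexHull ℝ _).smul_mem_of_zero_mem (hI.zero_mem_hull A) (indicator_mem_hull hX hXA)
    ⟨ht0, ht1⟩

/-- If a coordinate overflows, a multiple of `X` reaches the full gain in some coordinate. -/
theorem le_fopt_of_overflow (hI : I.WellFormed) (hg : NiceCost I.cost) (hs : Separable I.cost)
    (hX : X ∈ I.feasible) (hXA : X ⊆ A) (hXμ : ∀ e ∈ X, I.load μ e ≤ I.value e)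
    (hover : ¬ I.NoOverflow μ X) {c : ℝ} (hc : ∀ i, c ≤ marginalDual I.cost i (μ i)) :
    c ≤ I.fopt A := by
  classical
  set S : Fin d → ℝ := fun i => ∑ e ∈ X, I.size e i with hS
  have hS0 : ∀ i, 0 ≤ S i := sum_size_nonneg hI X
  set ψ : Fin d → ℝ → ℝ := fun i x => μ i * x - axisCost I.cost i x with hψ
  have hψ0 : ∀ i, ψ i 0 = 0 := fun i => by simp [hψ, hg.axisCost_zero]
  have hmax : ∀ i, ∃ p ∈ Icc 0 (S i), ∀ x ∈ Icc 0 (S i), ψ i x ≤ ψ i p := by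
    intro i
    have hcont : ContinuousOn (ψ i) (Icc 0 (S i)) :=
      ContinuousOn.sub (by fun_prop) ((hg.continuousOn_axisCost i).mono Icc_subset_Ici_self)
    exact isCompact_Icc.exists_isMaxOn (nonempty_Icc.2 (hS0 i)) hcont
  choose p hp hpmax using hmax
  -- The overflowing coordinates: there the maximizer `p i` of the gain on `[0, S i]` beats the
  -- right endpoint.
  set O : Finset (Fin d) := Finset.univ.filter fun i => ψ i (S i) < ψ i (p i) with hO
  have hOne : O.Nonempty := by
    unfold NoOverflow at hover
    push Not at hover
    obtain ⟨i, x, hx0, hxS, hlt⟩ := hover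
    exact ⟨i, Finset.mem_filter.2 ⟨Finset.mem_univ _, hlt.trans_le (hpmax i x ⟨hx0, hxS⟩)⟩⟩
  have hlt : ∀ i ∈ O, p i < S i := by
    intro i hi
    refine (hp i).2.lt_of_ne fun h => ?_
    have := (Finset.mem_filter.1 hi).2
    rw [h] at this
    exact this.false
  -- For such coordinates `p i` is a global maximizer: a better point beyond `S i` would by
  -- concavity force the gain at `S i` to be at least that at `p i`.
  have hfull : ∀ i ∈ O, c ≤ ψ i (p i) := by
    intro i hi
    refine (hc i).trans (marginalDual_le fun x hx => ?_)
    by_contra! hlt'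
    have hxS : S i ≤ x := by
      by_contra! h
      exact absurd (hpmax i x ⟨hx, h.le⟩) (not_le.2 hlt')
    have h := (hg.concaveOn_gain i (μ i)).min_le_of_mem_Icc (x := p i) (y := x) (z := S i)
      (hp i).1 hx ⟨(hp i).2, hxS⟩
    rw [min_eq_left hlt'.le] at h
    exact absurd (Finset.mem_filter.1 hi).2 (not_lt.2 h)
  -- Scaling by the smallest ratio puts coordinate `i₀` exactly at its optimum and brings every
  -- other overflowing coordinate to or below its own, so no gain is negative.
  obtain ⟨i₀, hi₀, hmin⟩ := O.exists_min_image (fun i => p i / S i) hOne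
  have hSpos : ∀ i ∈ O, 0 < S i := fun i hi => (hp i).1.trans_lt (hlt i hi)
  set t := p i₀ / S i₀ with ht
  have ht0 : 0 ≤ t := div_nonneg (hp i₀).1 (hS0 i₀)
  have ht1 : t ≤ 1 := (div_le_one (hSpos i₀ hi₀)).2 (hp i₀).2
  have hgain : ∀ i, 0 ≤ ψ i (t * S i) := by
    intro i
    by_cases hi : i ∈ O
    · have h1 : t * S i ≤ p i := by
        have := hmin i hi
        rwa [le_div_iff₀ (hSpos i hi)] at this
      refine gain_nonneg hg (mul_nonneg ht0 (hS0 i)) h1 ?_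
      have := hpmax i 0 ⟨le_rfl, hS0 i⟩
      rwa [hψ0] at this
    · refine gain_nonneg hg (mul_nonneg ht0 (hS0 i)) (mul_le_of_le_one_left (hS0 i) ht1) ?_
      have h1 : ψ i (p i) ≤ ψ i (S i) := by simpa [hO] using hi
      have h2 := hpmax i 0 ⟨le_rfl, hS0 i⟩
      rw [hψ0] at h2
      exact h2.trans h1
  refine le_trans ?_ (fracProfit_le_fopt hI hg (smul_indicator_mem_hull hI hX hXA ht0 ht1))
  have hy0 : ∀ e, 0 ≤ (t • Set.indicator (X : Set U) (fun _ => (1 : ℝ))) e := fun e =>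
    mul_nonneg ht0 (Set.indicator_nonneg (fun _ _ => zero_le_one) e)
  rw [fracProfit_eq_gain hI hg hs μ hy0]
  have hsz : ∀ i, ∑ e, (t • Set.indicator (X : Set U) (fun _ => (1 : ℝ))) e * I.size e i
      = t * S i := by
    intro i
    simp [hS, Finset.mul_sum, Set.indicator_apply]
  have hval : 0 ≤ ∑ e, (I.value e - I.load μ e) *
      (t • Set.indicator (X : Set U) (fun _ => (1 : ℝ))) e := by
    refine Finset.sum_nonneg fun e _ => ?_
    by_cases he : e ∈ X
    · exact mul_nonneg (sub_nonneg.2 (hXμ e he)) (hy0 e)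
    · simp [he]
  simp only [hsz]
  have h1 : ψ i₀ (t * S i₀) ≤ ∑ i, ψ i (t * S i) :=
    Finset.single_le_sum (fun i _ => hgain i) (Finset.mem_univ i₀)
  have h2 : t * S i₀ = p i₀ := div_mul_cancel₀ _ (hSpos i₀ hi₀).ne'
  rw [h2] at h1
  have h3 := hfull i₀ hi₀
  change c ≤ _ + ∑ i, ψ i (t * S i)
  linarith

/-- A feasible subset of `R` of largest size in coordinate `i`. -/
theorem exists_max_size (hI : I.WellFormed) (R : Finset U) (i : Fin d) :
    ∃ X ∈ I.feasible, X ⊆ R ∧ ∀ Y ∈ I.feasible, Y ⊆ R →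
      ∑ e ∈ Y, I.size e i ≤ ∑ e ∈ X, I.size e i := by
  obtain ⟨X, ⟨hX, hXR⟩, hmax⟩ := Set.exists_max_image {X | X ∈ I.feasible ∧ X ⊆ R}
    (fun X => ∑ e ∈ X, I.size e i) (Set.toFinite _)
    ⟨∅, hI.empty_feasible, Finset.empty_subset _⟩
  exact ⟨X, hX, hXR, fun Y hY hYR => hmax Y ⟨hY, hYR⟩⟩

theorem size_le_of_mem_hull {c : ℝ} {i : Fin d} {y : U → ℝ} (hy : y ∈ I.hull R)
    (h : ∀ Y ∈ I.feasible, Y ⊆ R → ∑ e ∈ Y, I.size e i ≤ c) : ∑ e, y e * I.size e i ≤ c := by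
  have := sum_mul_le_of_mem_hull (w := fun e => I.size e i) h hy
  simpa only [mul_comm] using this

theorem sum_mul_size_nonneg (hI : I.WellFormed) {y : U → ℝ} (hy : y ∈ I.hull A) (i : Fin d) :
    0 ≤ ∑ e, y e * I.size e i :=
  Finset.sum_nonneg fun e _ => mul_nonneg (nonneg_of_mem_hull hy e) (hI.size_nonneg e i)

/-- Weak duality: at prices for which no coordinate overflows. -/
theorem fopt_univ_le (hI : I.WellFormed) (hg : NiceCost I.cost) (hs : Separable I.cost)
    (hno : ∀ X ∈ I.feasible, X ⊆ I.strictPicked Finset.univ μ → I.NoOverflow μ X) {c : ℝ}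
    (hc : ∀ i, marginalDual I.cost i (μ i) ≤ c) :
    I.fopt Finset.univ ≤ I.fopt (I.strictPicked Finset.univ μ) + d * c := by
  classical
  refine fopt_le hI fun y hy => ?_
  set P := I.strictPicked Finset.univ μ with hP
  -- Dropping the items that are not strictly picked loses no reduced value, and the remaining gains
  -- are nonnegative; the only possible loss is the gains of `y`, at most `c` per coordinate.
  set z := Set.indicator (P : Set U) y with hz
  have hy0 := nonneg_of_mem_hull hy
  have hzP : z ∈ I.hull P := by
    have := hI.indicator_mem_hull_inter hy P
    rwa [Finset.univ_inter] at this
  have h1 := fracProfit_le_fopt hI hg hzP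
  rw [fracProfit_eq_gain hI hg hs μ (nonneg_of_mem_hull hzP)] at h1
  rw [fracProfit_eq_gain hI hg hs μ hy0]
  have h2 : ∑ e, (I.value e - I.load μ e) * y e ≤ ∑ e, (I.value e - I.load μ e) * z e := by
    refine Finset.sum_le_sum fun e _ => ?_
    by_cases he : e ∈ P
    · simp [hz, he]
    · have : I.value e ≤ I.load μ e := by simpa [hP, mem_strictPicked] using he
      simp only [hz, Set.indicator_of_notMem (show e ∉ (P : Set U) from he), mul_zero]
      exact mul_nonpos_of_nonpos_of_nonneg (sub_nonpos.2 this) (hy0 e)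
  have h3 : 0 ≤ ∑ i, (μ i * (∑ e, z e * I.size e i) -
      axisCost I.cost i (∑ e, z e * I.size e i)) := by
    refine Finset.sum_nonneg fun i _ => ?_
    obtain ⟨X, hX, hXP, hmax⟩ := exists_max_size hI P i
    exact (hno X hX hXP).gain_nonneg hI hg i (sum_mul_size_nonneg hI hzP i)
      (size_le_of_mem_hull hzP hmax)
  have h4 : ∑ i, (μ i * (∑ e, y e * I.size e i) -
      axisCost I.cost i (∑ e, y e * I.size e i)) ≤ d * c := by
    calc _ ≤ ∑ _i : Fin d, c := Finset.sum_le_sum fun i _ =>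
          (hg.le_marginalDual i _ (sum_mul_size_nonneg hI hy i)).trans (hc i)
      _ = d * c := by simp
  linarith

theorem sum_reduced_nonneg (hR : ∀ e ∈ R, I.load μ e ≤ I.value e) (hX : X ⊆ R) :
    0 ≤ ∑ e ∈ X, (I.value e - I.load μ e) :=
  Finset.sum_nonneg fun e he => sub_nonneg.2 (hR e (hX he))

/-- The integrality gap is at most `d + 1` when no coordinate overflows. -/
theorem fopt_le_mul_opt (hI : I.WellFormed) (hg : NiceCost I.cost) (hs : Separable I.cost)
    (hR : ∀ e ∈ R, I.load μ e ≤ I.value e)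
    (hno : ∀ X ∈ I.feasible, X ⊆ R → I.NoOverflow μ X) :
    I.fopt R ≤ (d + 1) * I.opt R := by
  refine fopt_le hI fun y hy => ?_
  rw [fracProfit_eq_gain hI hg hs μ (nonneg_of_mem_hull hy)]
  have hgain : ∀ X ∈ I.feasible, X ⊆ R → ∀ i, 0 ≤ μ i * (∑ e ∈ X, I.size e i) -
      axisCost I.cost i (∑ e ∈ X, I.size e i) := fun X hX hXR i =>
    (hno X hX hXR).gain_nonneg hI hg i (sum_size_nonneg hI X i) le_rfl
  have h1 : ∑ e, (I.value e - I.load μ e) * y e ≤ I.opt R := by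
    refine sum_mul_le_of_mem_hull (fun X hX hXR => ?_) hy
    refine le_trans ?_ (profit_le_opt hX hXR)
    rw [profit_eq_gain hI hg hs μ]
    exact le_add_of_nonneg_right (Finset.sum_nonneg fun i _ => hgain X hX hXR i)
  have h2 : ∀ i, μ i * (∑ e, y e * I.size e i) - axisCost I.cost i (∑ e, y e * I.size e i) ≤
      I.opt R := by
    intro i
    -- The integral set of largest size in coordinate `i` has the largest gain there, because the
    -- gain has its maximum over `[0, size of X]` at the right end.
    obtain ⟨X, hX, hXR, hmax⟩ := exists_max_size hI R i
    refine (hno X hX hXR i _ (sum_mul_size_nonneg hI hy i) (size_le_of_mem_hull hy hmax)).trans ?_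
    refine le_trans ?_ (profit_le_opt hX hXR)
    rw [profit_eq_gain hI hg hs μ]
    have h := Finset.single_le_sum (fun i _ => hgain X hX hXR i) (Finset.mem_univ i)
    have h' := sum_reduced_nonneg hR hXR
    linarith
  have h3 := Finset.sum_le_sum fun i (_ : i ∈ Finset.univ) => h2 i
  simp only [Finset.sum_const, Finset.card_univ, Fintype.card_fin, nsmul_eq_mul] at h3
  linarith

/-- A concave function whose maximum on `[0, q]` is at `q` increases up to `q`; freezing it there
preserves both monotonicity and concavity. -/
theorem concaveOn_gain_min (hg : NiceCost I.cost) {i : Fin d} {y q : ℝ} (hq0 : 0 ≤ q)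
    (hq : ∀ x, 0 ≤ x → x ≤ q →
      y * x - axisCost I.cost i x ≤ y * q - axisCost I.cost i q) :
    MonotoneOn (fun x => y * min x q - axisCost I.cost i (min x q)) (Ici 0) ∧
      ConcaveOn ℝ (Ici 0) fun x => y * min x q - axisCost I.cost i (min x q) := by
  have hcon := hg.concaveOn_gain i y
  have hmono : MonotoneOn (fun x => y * x - axisCost I.cost i x) (Icc 0 q) := by
    intro a ha b hb hab
    have h := hcon.min_le_of_mem_Icc (x := a) (y := q) (z := b) ha.1 hq0 ⟨hab, hb.2⟩
    rwa [min_eq_left (hq a ha.1 ha.2)] at h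
  have hmem : ∀ x ∈ Ici (0 : ℝ), min x q ∈ Icc 0 q := fun x hx =>
    ⟨le_min hx hq0, min_le_right _ _⟩
  refine ⟨fun a ha b hb hab => hmono (hmem a ha) (hmem b hb) (min_le_min_right q hab),
    convex_Ici 0, fun a ha b hb s t hs ht hst => ?_⟩
  have h1 := hcon.2 (hmem a ha).1 (hmem b hb).1 hs ht hst
  refine h1.trans ?_
  have hconv : s • min a q + t • min b q ∈ Icc 0 q :=
    (convex_Icc 0 q) (hmem a ha) (hmem b hb) hs ht hst
  refine hmono hconv (hmem _ (convex_Ici 0 ha hb hs ht hst)) (le_min ?_ hconv.2)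
  simp only [smul_eq_mul]
  gcongr <;> exact min_le_left _ _

/-- If no feasible subset of `R` overflows, then the profit agrees on these sets with a nonnegative
monotone submodular function. -/
theorem exists_monotoneSubmodular [DecidableEq U] (hI : I.WellFormed) (hg : NiceCost I.cost)
    (hs : Separable I.cost) (hR : ∀ e ∈ R, I.load μ e ≤ I.value e)
    (hno : ∀ X ∈ I.feasible, X ⊆ R → I.NoOverflow μ X) :
    ∃ f : Finset U → ℝ, MonotoneSubmodular f ∧ ∀ X ∈ I.feasible, X ⊆ R → f X = I.profit X := by
  -- Freezing each gain at the largest size of a feasible subset of `R` makes it monotone without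
  -- changing it on those subsets.
  choose Y hY hYR hmax using exists_max_size hI R
  set q : Fin d → ℝ := fun i => ∑ e ∈ Y i, I.size e i with hq
  set φ : Fin d → ℝ → ℝ := fun i x => μ i * min x (q i) - axisCost I.cost i (min x (q i)) with hφ
  have hq0 : ∀ i, 0 ≤ q i := fun i => sum_size_nonneg hI _ i
  have hφmc : ∀ i, MonotoneOn (φ i) (Ici 0) ∧ ConcaveOn ℝ (Ici 0) (φ i) := fun i =>
    concaveOn_gain_min hg (hq0 i) (hno _ (hY i) (hYR i) i)
  -- Items outside `R` are neutralized: their reduced values may be negative, which would destroy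
  -- monotonicity on the full power set.
  set w : U → ℝ := fun e => if e ∈ R then I.value e - I.load μ e else 0 with hw
  set a : U → Fin d → ℝ := fun e i => if e ∈ R then I.size e i else 0 with ha
  have ha0 : ∀ e i, 0 ≤ a e i := by
    intro e i
    simp only [ha]
    split_ifs
    exacts [hI.size_nonneg e i, le_rfl]
  have hw0 : ∀ e, 0 ≤ w e := by
    intro e
    simp only [hw]
    split_ifs with h
    exacts [sub_nonneg.2 (hR e h), le_rfl]
  set f : Finset U → ℝ := fun A => ∑ e ∈ A, w e + ∑ i, φ i (∑ e ∈ A, a e i) with hf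
  have hmono : ∀ A B, A ⊆ B → f A ≤ f B := by
    intro A B hAB
    refine add_le_add (Finset.sum_le_sum_of_subset_of_nonneg hAB fun e _ _ => hw0 e)
      (Finset.sum_le_sum fun i _ => (hφmc i).1 ?_ ?_ ?_)
    · exact Finset.sum_nonneg fun e _ => ha0 e i
    · exact Finset.sum_nonneg fun e _ => ha0 e i
    · exact Finset.sum_le_sum_of_subset_of_nonneg hAB fun e _ _ => ha0 e i
  have hempty : f ∅ = 0 := by simp [hf, hφ, hq0, hg.axisCost_zero]
  refine ⟨f, ⟨fun A => hempty ▸ hmono ∅ A (Finset.empty_subset _), hmono,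
    sum_union_add_sum_inter ha0 fun i => (hφmc i).2, hempty⟩, fun X hX hXR => ?_⟩
  rw [profit_eq_gain hI hg hs μ]
  have h1 : ∑ e ∈ X, w e = ∑ e ∈ X, (I.value e - I.load μ e) :=
    Finset.sum_congr rfl fun e he => if_pos (hXR he)
  have h2 : ∀ i, ∑ e ∈ X, a e i = ∑ e ∈ X, I.size e i := fun i =>
    Finset.sum_congr rfl fun e he => if_pos (hXR he)
  simp only [hf, h1, h2, hφ]
  congr 1
  refine Finset.sum_congr rfl fun i _ => ?_
  rw [min_eq_left (hmax i X hX hXR)]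

end Classifier

/-! ### Thresholds on the curve -/

section Curve

variable {d : ℕ} {U : Type u} [Fintype U] {I : Instance d U} {A R X : Finset U}
  {γ : ℝ≥0 → Fin d → ℝ}

theorem continuous_load (hγ : Continuous γ) (e : U) : Continuous fun t => I.load (γ t) e := by
  unfold load
  fun_prop

theorem tendsto_load (hI : I.WellFormed) (hγm : Monotone γ) (hγ0 : γ 0 = 0)
    (hγt : ∀ i, Tendsto (fun t => γ t i) atTop atTop) (e : U) :
    Tendsto (fun t => I.load (γ t) e) atTop atTop := by
  obtain ⟨i, hi⟩ : ∃ i, I.size e i ≠ 0 := by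
    by_contra! h
    exact hI.size_ne_zero e (funext h)
  have hpos : 0 < I.size e i := (hI.size_nonneg e i).lt_of_ne' hi
  refine tendsto_atTop_mono (fun t => ?_) ((hγt i).atTop_mul_const hpos)
  refine Finset.single_le_sum (f := fun i => γ t i * I.size e i) (fun j _ => ?_)
    (Finset.mem_univ i)
  have h := hγm (zero_le (a := t)) j
  rw [hγ0] at h
  exact mul_nonneg h (hI.size_nonneg e j)

/-- Along the curve there is a last time at which the fractional optimum of the picked items
reaches a lower semicontinuous, eventually positive demand. -/
theorem exists_isGreatest_time (hI : I.WellFormed) (hg : NiceCost I.cost) (hγ : Continuous γ)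
    (hγm : Monotone γ) (hγ0 : γ 0 = 0) (hγt : ∀ i, Tendsto (fun t => γ t i) atTop atTop)
    {ρ : ℝ≥0 → ℝ} (hρ : LowerSemicontinuous ρ) (hρ0 : ρ 0 ≤ I.fopt A)
    (hρt : ∀ᶠ t in atTop, 0 < ρ t) :
    ∃ t₀, IsGreatest {t | ρ t ≤ I.fopt (I.picked A (γ t))} t₀ := by
  set T := {t | ρ t ≤ I.fopt (I.picked A (γ t))} with hT
  -- Rejection is an open condition, so near `t` the picked set can only shrink, while lower
  -- semicontinuity keeps the demand above the old `fopt`.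
  have hclosed : IsClosed T := by
    rw [← isOpen_compl_iff, isOpen_iff_mem_nhds]
    intro t ht
    simp only [hT, mem_compl_iff, mem_ofPred_eq, not_le] at ht
    have h1 : ∀ᶠ s in 𝓝 t, I.fopt (I.picked A (γ t)) < ρ s := hρ t _ ht
    have h2 : ∀ᶠ s in 𝓝 t, ∀ e, I.value e < I.load (γ t) e → I.value e < I.load (γ s) e := by
      refine eventually_all.2 fun e => ?_
      by_cases h : I.value e < I.load (γ t) e
      · filter_upwards [(continuous_load hγ e).continuousAt.eventually (lt_mem_nhds h)] with s hs _
        exact hs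
      · exact Eventually.of_forall fun s hs => absurd hs h
    filter_upwards [h1, h2] with s hs1 hs2
    simp only [hT, mem_compl_iff, mem_ofPred_eq, not_le]
    refine (fopt_mono hI hg fun e he => ?_).trans_lt hs1
    rw [mem_picked] at he ⊢
    exact ⟨he.1, not_lt.1 fun h => (hs2 e h).not_ge he.2⟩
  have hne : (0 : ℝ≥0) ∈ T := by
    have h : I.picked A (γ 0) = A := by
      ext e
      simp [mem_picked, hγ0, load, hI.value_nonneg e]
    simpa only [hT, mem_ofPred_eq, h] using hρ0
  have hbdd : BddAbove T := by
    have h1 : ∀ᶠ t in atTop, ∀ e, I.value e < I.load (γ t) e :=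
      eventually_all.2 fun e => (tendsto_load hI hγm hγ0 hγt e).eventually_gt_atTop _
    obtain ⟨t₁, ht₁⟩ := eventually_atTop.1 (h1.and hρt)
    refine ⟨t₁, fun t ht => ?_⟩
    by_contra! hlt
    obtain ⟨h2, h3⟩ := ht₁ t hlt.le
    have h4 : I.picked A (γ t) = ∅ := by
      ext e
      simp [mem_picked, (h2 e)]
    simp only [hT, mem_ofPred_eq, h4, fopt_empty hI hg] at ht
    exact ht.not_gt h3
  exact ⟨sSup T, hclosed.csSup_mem ⟨0, hne⟩ hbdd, fun t ht => le_csSup hbdd ht⟩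

/-- The last time at which the fractional optimum of the picked items reaches the common value of
the marginal duals. -/
theorem exists_isGreatest_balance (hI : I.WellFormed) (hg : NiceCost I.cost) (hγ : Continuous γ)
    (hγm : Monotone γ) (hγ0 : γ 0 = 0) (hγt : ∀ i, Tendsto (fun t => γ t i) atTop atTop)
    (i : Fin d) : ∃ t₀, IsGreatest {t | marginalDual I.cost i (γ t i) ≤
      I.fopt (I.picked Finset.univ (γ t))} t₀ := by
  refine exists_isGreatest_time hI hg hγ hγm hγ0 hγt ?_ ?_ ?_
  · intro t a ha
    exact ((continuous_apply i).comp hγ).continuousAt.eventually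
      (hg.lowerSemicontinuous_marginalDual i _ a ha)
  · rw [hγ0]
    refine (marginalDual_le fun x hx => ?_).trans (fopt_nonneg hI hg _)
    simpa using hg.axisCost_nonneg i hx
  · filter_upwards [(hγt i).eventually_gt_atTop (axisCost I.cost i 1)] with t ht
    have := hg.le_marginalDual i (γ t i) zero_le_one
    linarith

/-- Strict picking and overflow are open conditions, so an overflow at `t` persists at some later `s
> t`. There it forces `fopt` of the picked items up to the dual value, although `t₀` is the last
time this happens. Hence the claim includes `t = t₀`, where it is needed for weak duality. -/
theorem noOverflow_of_le (hI : I.WellFormed) (hg : NiceCost I.cost) (hs : Separable I.cost)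
    (hγ : Continuous γ)
    (hγb : ∀ t i j, marginalDual I.cost i (γ t i) = marginalDual I.cost j (γ t j))
    {i : Fin d} {t₀ t : ℝ≥0} (ht₀ : IsGreatest {t | marginalDual I.cost i (γ t i) ≤
      I.fopt (I.picked Finset.univ (γ t))} t₀) (ht : t₀ ≤ t) (hX : X ∈ I.feasible)
    (hXt : X ⊆ I.strictPicked Finset.univ (γ t)) : I.NoOverflow (γ t) X := by
  by_contra hover
  have hover' := hover
  unfold NoOverflow at hover'
  push Not at hover'
  obtain ⟨j, x, hx0, hxS, hlt⟩ := hover'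
  have h1 : ∀ᶠ s in 𝓝 t, ∀ e, e ∈ X → I.load (γ s) e < I.value e := by
    refine eventually_all.2 fun e => ?_
    by_cases he : e ∈ X
    · filter_upwards [(continuous_load hγ e).continuousAt.eventually
        (gt_mem_nhds (mem_strictPicked.1 (hXt he)).2)] with s hs _
      exact hs
    · exact Eventually.of_forall fun s hs => absurd hs he
  have h2 : ∀ᶠ s in 𝓝 t, γ s j * (∑ e ∈ X, I.size e j) -
      axisCost I.cost j (∑ e ∈ X, I.size e j) < γ s j * x - axisCost I.cost j x := by
    have hc1 : Continuous fun s => γ s j * (∑ e ∈ X, I.size e j) -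
      axisCost I.cost j (∑ e ∈ X, I.size e j) := by fun_prop
    have hc2 : Continuous fun s => γ s j * x - axisCost I.cost j x := by fun_prop
    exact hc1.continuousAt.eventually_lt hc2.continuousAt hlt
  obtain ⟨s, ⟨hs1, hs2⟩, hts⟩ :=
    (((h1.and h2).filter_mono nhdsWithin_le_nhds).and
      (self_mem_nhdsWithin (a := t) (s := Ioi t))).exists
  have hs3 : ¬ I.NoOverflow (γ s) X := fun h => (h j x hx0 hxS).not_gt hs2
  have hs4 := le_fopt_of_overflow (A := I.picked Finset.univ (γ s)) hI hg hs hX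
    (fun e he => mem_picked.2 ⟨Finset.mem_univ _, (hs1 e he).le⟩) (fun e he => (hs1 e he).le) hs3
    (c := marginalDual I.cost i (γ s i)) fun k => (hγb s i k).le
  exact (ht₀.2 hs4).not_gt (ht.trans_lt hts)

end Curve

end Instance

/-! ### Random orders -/

section Orders

variable {U : Type u} [DecidableEq U]

/-- The orders of a finite set. -/
def orders (X : Finset U) : Finset (List U) := X.val.lists.toFinset

theorem mem_orders {X : Finset U} {l : List U} : l ∈ orders X ↔ l.Nodup ∧ l.toFinset = X := by
  rw [orders, Multiset.mem_toFinset, Multiset.mem_lists_iff]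
  constructor
  · intro h
    have hnd : l.Nodup := by
      have h' : X.val = (l : Multiset U) := h
      rw [← Multiset.coe_nodup, ← h']
      exact X.nodup
    refine ⟨hnd, Finset.eq_of_veq ?_⟩
    rw [List.toFinset_val, hnd.dedup, h]
    rfl
  · rintro ⟨hnd, rfl⟩
    rw [List.toFinset_val, hnd.dedup]
    rfl

theorem length_of_mem_orders {X : Finset U} {l : List U} (hl : l ∈ orders X) :
    l.length = X.card := by
  obtain ⟨hnd, rfl⟩ := mem_orders.1 hl
  exact (List.toFinset_card_of_nodup hnd).symm

theorem card_orders (X : Finset U) : (orders X).card = X.card.factorial := by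
  have h : X.val.lists.Nodup := Multiset.lists_nodup_finset X
  rw [orders, Multiset.toFinset_card_of_nodup h, ← X.coe_toList, Multiset.lists_coe,
    Multiset.coe_card, List.length_permutations, X.length_toList]

theorem expect_uniformOfFinset_bind {α : Type u} [Fintype α] {ι : Type*} (s : Finset ι)
    (hs : s.Nonempty) (f : ι → PMF α) (h : α → ℝ) :
    expect ((PMF.uniformOfFinset s hs).bind f) h = (∑ x ∈ s, expect (f x) h) / s.card := by
  have key : ∀ a, (((PMF.uniformOfFinset s hs).bind f) a).toReal =
      (∑ x ∈ s, (f x a).toReal) / s.card := by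
    intro a
    rw [PMF.bind_apply, tsum_eq_sum (s := s) fun x hx => by
      rw [PMF.uniformOfFinset_apply_of_notMem hs hx, zero_mul]]
    rw [ENNReal.toReal_sum fun x _ => ENNReal.mul_ne_top (PMF.apply_ne_top _ _)
      (PMF.apply_ne_top _ _), Finset.sum_div]
    refine Finset.sum_congr rfl fun x hx => ?_
    rw [PMF.uniformOfFinset_apply_of_mem hs hx, ENNReal.toReal_mul, ENNReal.toReal_inv,
      ENNReal.toReal_natCast]
    ring
  simp only [expect, key, Finset.sum_div, Finset.sum_mul]
  rw [Finset.sum_comm]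
  refine Finset.sum_congr rfl fun x _ => Finset.sum_congr rfl fun a _ => ?_
  ring

theorem expect_randomOrder_bind {α : Type u} [Fintype α] (X : Finset U) (f : List U → PMF α)
    (h : α → ℝ) : expect ((randomOrder X).bind f) h =
      (∑ l ∈ orders X, expect (f l) h) / X.card.factorial := by
  rw [← card_orders]
  exact expect_uniformOfFinset_bind _ _ _ _

theorem expect_binomialHalf_bind {α : Type u} [Fintype α] (n : ℕ) (f : ℕ → PMF α)
    (h : α → ℝ) : expect ((binomialHalf n).bind f) h =
      (∑ k ∈ Finset.range (n + 1), (n.choose k : ℝ) * expect (f k) h) / 2 ^ n := by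
  rw [binomialHalf, PMF.bind_map, PMF.uniformOfFintype, expect_uniformOfFinset_bind]
  congr 1
  · have h1 : ∑ c : Fin n → Bool, expect (f (Finset.univ.filter fun i => c i = true).card) h =
        ∑ T : Finset (Fin n), expect (f T.card) h := by
      refine Finset.sum_bij' (fun c _ => Finset.univ.filter fun i => c i = true)
        (fun T _ i => decide (i ∈ T)) ?_ ?_ ?_ ?_ ?_ <;> intros <;> simp
    have h2 := Finset.sum_powerset_apply_card (x := (Finset.univ : Finset (Fin n)))
      fun k => expect (f k) h
    simp only [Finset.powerset_univ, Finset.card_univ, Fintype.card_fin, nsmul_eq_mul] at h2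
    exact h1.trans h2
  · simp

/-- An order of `U` is a choice of the set `S` of its first `k` elements with an order of `S` and
one of the complement; only the order of `S` is forgotten, hence the factor `k!`. -/
theorem sum_orders_univ_split [Fintype U] (Φ : Finset U → List U → ℝ) {k : ℕ}
    (hk : k ≤ Fintype.card U) :
    ∑ l ∈ orders (Finset.univ : Finset U), Φ (l.take k).toFinset (l.drop k) =
      ∑ S ∈ Finset.powersetCard k Finset.univ,
        (k.factorial : ℝ) * ∑ b ∈ orders Sᶜ, Φ S b := by
  have hlen : ∀ l ∈ orders (Finset.univ : Finset U), l.length = Fintype.card U := fun l hl =>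
    (length_of_mem_orders hl).trans Finset.card_univ
  have htake : ∀ l ∈ orders (Finset.univ : Finset U), (l.take k).toFinset.card = k := by
    intro l hl
    rw [List.toFinset_card_of_nodup ((mem_orders.1 hl).1.sublist (List.take_sublist _ _)),
      List.length_take, hlen l hl, min_eq_left hk]
  rw [← Finset.sum_fiberwise_of_maps_to (s := orders Finset.univ)
    (t := Finset.powersetCard k Finset.univ) (g := fun l => (l.take k).toFinset)
    fun l hl => Finset.mem_powersetCard.2 ⟨Finset.subset_univ _, htake l hl⟩]
  refine Finset.sum_congr rfl fun S hS => ?_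
  have hSk := (Finset.mem_powersetCard.1 hS).2
  have hprod : (k.factorial : ℝ) * ∑ b ∈ orders Sᶜ, Φ S b =
      ∑ p ∈ orders S ×ˢ orders Sᶜ, Φ S p.2 := by
    rw [Finset.sum_product]
    simp only [Finset.sum_const, card_orders, hSk, nsmul_eq_mul]
  rw [hprod]
  refine Finset.sum_bij' (fun l _ => (l.take k, l.drop k)) (fun p _ => p.1 ++ p.2) ?_ ?_ ?_ ?_ ?_
  · intro l hl
    obtain ⟨hl, hlS⟩ := Finset.mem_filter.1 hl
    obtain ⟨hnd, huniv⟩ := mem_orders.1 hl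
    have hnd' : (l.take k ++ l.drop k).Nodup := by rwa [List.take_append_drop]
    refine Finset.mem_product.2 ⟨mem_orders.2 ⟨hnd.sublist (List.take_sublist _ _), hlS⟩,
      mem_orders.2 ⟨hnd.sublist (List.drop_sublist _ _), ?_⟩⟩
    ext e
    have hdisj := List.disjoint_of_nodup_append hnd'
    have hmem : e ∈ l.take k ∨ e ∈ l.drop k := by
      rw [← List.mem_append, List.take_append_drop, ← List.mem_toFinset, huniv]
      exact Finset.mem_univ e
    rw [Finset.mem_compl, ← hlS, List.mem_toFinset, List.mem_toFinset]
    exact ⟨fun h1 h2 => hdisj h2 h1, hmem.resolve_left⟩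
  · rintro ⟨a, b⟩ hp
    obtain ⟨ha, hb⟩ := Finset.mem_product.1 hp
    have hal := length_of_mem_orders ha
    obtain ⟨ha, haS⟩ := mem_orders.1 ha
    obtain ⟨hb, hbS⟩ := mem_orders.1 hb
    simp only at haS hbS hal ⊢
    refine Finset.mem_filter.2 ⟨mem_orders.2 ⟨List.nodup_append'.2 ⟨ha, hb, ?_⟩, ?_⟩, ?_⟩
    · intro e h1 h2
      rw [← List.mem_toFinset, haS] at h1
      rw [← List.mem_toFinset, hbS, Finset.mem_compl] at h2
      exact h2 h1
    · rw [List.toFinset_append, haS, hbS, Finset.union_compl]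
    · rw [← hSk, ← hal, List.take_left', haS]
      rfl
  · intro l _
    exact List.take_append_drop _ _
  · rintro ⟨a, b⟩ hp
    have hal := (length_of_mem_orders (Finset.mem_product.1 hp).1).trans hSk
    exact Prod.ext (List.take_left' hal) (List.drop_left' hal)
  · intro l hl
    rw [(Finset.mem_filter.1 hl).2]

/-- The first `Binomial(n, 1/2)` elements of a random order form a uniformly random subset, and the
other elements come in uniformly random order. -/
theorem sum_orders_univ_binomial [Fintype U] (Φ : Finset U → List U → ℝ) :
    (∑ l ∈ orders (Finset.univ : Finset U),
      (∑ k ∈ Finset.range (Fintype.card U + 1),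
        ((Fintype.card U).choose k : ℝ) * Φ (l.take k).toFinset (l.drop k)) /
          2 ^ Fintype.card U) / (Fintype.card U).factorial =
      (∑ S : Finset U, (∑ b ∈ orders Sᶜ, Φ S b) / (Sᶜ.card.factorial : ℝ)) /
        2 ^ Fintype.card U := by
  set n := Fintype.card U with hn
  rw [← Finset.sum_div, div_right_comm]
  congr 1
  rw [Finset.sum_comm, Finset.sum_div, ← Finset.powerset_univ,
    Finset.sum_powerset (Finset.univ : Finset U), Finset.card_univ, ← hn]
  refine Finset.sum_congr rfl fun k hk => ?_
  have hkn : k ≤ n := Nat.lt_succ_iff.1 (Finset.mem_range.1 hk)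
  rw [← Finset.mul_sum, sum_orders_univ_split Φ hkn, Finset.mul_sum, Finset.sum_div]
  refine Finset.sum_congr rfl fun S hS => ?_
  rw [Finset.card_compl, (Finset.mem_powersetCard.1 hS).2, ← hn]
  -- The binomial weight exactly turns the uniform distribution on `k`-sets into the uniform
  -- distribution on all subsets.
  have h : (n.choose k : ℝ) * k.factorial * (n - k).factorial = n.factorial := by
    exact_mod_cast Nat.choose_mul_factorial_mul_factorial hkn
  have h1 : (n.factorial : ℝ) ≠ 0 := Nat.cast_ne_zero.2 (Nat.factorial_ne_zero _)
  have h2 : ((n - k).factorial : ℝ) ≠ 0 := Nat.cast_ne_zero.2 (Nat.factorial_ne_zero _)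
  rw [div_eq_div_iff h1 h2, ← h]
  ring

/-- Relabelling symmetry: used to show that all orders of a filtered subset extend to equally many
orders of the whole set. -/
theorem exists_perm_map_eq {X : Finset U} {l l' : List U} (hl : l ∈ orders X)
    (hl' : l' ∈ orders X) :
    ∃ τ : Equiv.Perm U, l.map τ = l' ∧ (∀ e, τ e ∈ X ↔ e ∈ X) ∧ ∀ e, e ∉ X → τ e = e := by
  have hlen : l.length = l'.length :=
    (length_of_mem_orders hl).trans (length_of_mem_orders hl').symm
  obtain ⟨hnd, hX⟩ := mem_orders.1 hl
  obtain ⟨hnd', hX'⟩ := mem_orders.1 hl'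
  have hm : ∀ e, e ∈ l ↔ e ∈ X := fun e => by rw [← List.mem_toFinset, hX]
  have hm' : ∀ e, e ∈ l' ↔ e ∈ X := fun e => by rw [← List.mem_toFinset, hX']
  let σ : Equiv.Perm {e // e ∈ X} :=
    (((Equiv.subtypeEquivRight hm).symm.trans (hnd.getEquiv l).symm).trans
      (finCongr hlen)).trans ((hnd'.getEquiv l').trans (Equiv.subtypeEquivRight hm'))
  refine ⟨Equiv.Perm.ofSubtype σ, List.ext_getElem (by simpa using hlen) fun i h1 h2 => ?_,
    fun e => Equiv.Perm.ofSubtype_apply_mem_iff_mem σ e,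
    fun e he => Equiv.Perm.ofSubtype_apply_of_not_mem σ he⟩
  have hi : i < l.length := by simpa using h1
  have hmem : l[i] ∈ X := (hm _).1 (List.getElem_mem hi)
  rw [List.getElem_map, Equiv.Perm.ofSubtype_apply_of_mem σ hmem]
  have hidx : (hnd.getEquiv l).symm ⟨l[i], List.getElem_mem hi⟩ = ⟨i, hi⟩ := by
    rw [Equiv.symm_apply_eq]
    rfl
  change ((hnd'.getEquiv l') (finCongr hlen
    ((hnd.getEquiv l).symm ⟨l[i], List.getElem_mem hi⟩)) : U) = l'[i]
  rw [hidx]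
  rfl

/-- The elements satisfying `p` in a uniformly random order are in uniformly random order. -/
theorem sum_orders_filter (X : Finset U) (p : U → Prop) [DecidablePred p] (φ : List U → ℝ) :
    (∑ l ∈ orders X, φ (l.filter p)) / (X.card.factorial : ℝ) =
      (∑ r ∈ orders (X.filter p), φ r) / ((X.filter p).card.factorial : ℝ) := by
  have hmaps : ∀ l ∈ orders X, l.filter p ∈ orders (X.filter p) := by
    intro l hl
    obtain ⟨hnd, rfl⟩ := mem_orders.1 hl
    refine mem_orders.2 ⟨hnd.filter _, ?_⟩
    ext e
    simp
  set N : List U → ℕ := fun r => ((orders X).filter fun l => l.filter p = r).card with hN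
  -- A permutation carrying `r` to `r'` and fixing all items outside the filtered set injects one
  -- fibre into the other; exchanging the roles gives equal sizes.
  have hle : ∀ r ∈ orders (X.filter p), ∀ r' ∈ orders (X.filter p), N r ≤ N r' := by
    intro r hr r' hr'
    obtain ⟨τ, hτ, hτX, hτ'⟩ := exists_perm_map_eq hr hr'
    have hτp : ∀ e ∈ X, τ e ∈ X ∧ (p (τ e) ↔ p e) := by
      intro e he
      by_cases hpe : p e
      · have h := (hτX e).2 (Finset.mem_filter.2 ⟨he, hpe⟩)
        exact ⟨(Finset.mem_filter.1 h).1, iff_of_true (Finset.mem_filter.1 h).2 hpe⟩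
      · rw [hτ' e fun h => hpe (Finset.mem_filter.1 h).2]
        exact ⟨he, Iff.rfl⟩
    refine Finset.card_le_card_of_injOn (List.map τ) (fun l hl => ?_)
      (List.map_injective_iff.2 τ.injective).injOn
    obtain ⟨hlo, rfl⟩ := Finset.mem_filter.1 hl
    obtain ⟨hnd, hlX⟩ := mem_orders.1 hlo
    have hmem : ∀ e, e ∈ l → e ∈ X := fun e he => hlX ▸ List.mem_toFinset.2 he
    refine Finset.mem_filter.2 ⟨mem_orders.2 ⟨hnd.map τ.injective, ?_⟩, ?_⟩
    · refine Finset.eq_of_subset_of_card_le (fun e he => ?_) ?_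
      · obtain ⟨a, ha, rfl⟩ := List.mem_map.1 (List.mem_toFinset.1 he)
        exact (hτp a (hmem a ha)).1
      · rw [List.toFinset_card_of_nodup (hnd.map τ.injective), List.length_map,
          length_of_mem_orders hlo]
    · rw [← hτ, List.filter_map]
      congr 1
      refine List.filter_congr fun e he => ?_
      simp only [Function.comp_apply, decide_eq_decide]
      exact (hτp e (hmem e he)).2
  obtain ⟨r₀, hr₀⟩ := orders_nonempty (X.filter p)
  have hconst : ∀ r ∈ orders (X.filter p), N r = N r₀ := fun r hr =>
    (hle r hr r₀ hr₀).antisymm (hle r₀ hr₀ r hr)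
  have hcard : (X.card.factorial : ℝ) = (X.filter p).card.factorial * N r₀ := by
    rw [← card_orders X, Finset.card_eq_sum_card_fiberwise hmaps, Finset.sum_congr rfl hconst,
      Finset.sum_const, card_orders, smul_eq_mul, Nat.cast_mul]
  have hsum : ∑ l ∈ orders X, φ (l.filter p) = N r₀ * ∑ r ∈ orders (X.filter p), φ r := by
    rw [← Finset.sum_fiberwise_of_maps_to hmaps, Finset.mul_sum]
    refine Finset.sum_congr rfl fun r hr => ?_
    rw [← hconst r hr, Finset.sum_congr rfl fun l hl => by rw [(Finset.mem_filter.1 hl).2],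
      Finset.sum_const, nsmul_eq_mul]
  have h1 : (X.card.factorial : ℝ) ≠ 0 := Nat.cast_ne_zero.2 (Nat.factorial_ne_zero _)
  have h2 : ((X.filter p).card.factorial : ℝ) ≠ 0 := Nat.cast_ne_zero.2 (Nat.factorial_ne_zero _)
  rw [hsum, div_eq_div_iff h1 h2, hcard]
  ring

end Orders

/-! ### Running the subroutine -/

section Run

variable {U : Type u}

theorem map_congr_of_support {α β : Type*} {p : PMF α} {f g : α → β}
    (h : ∀ a ∈ p.support, f a = g a) : p.map f = p.map g := by
  ext b
  rw [PMF.map_apply, PMF.map_apply]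
  refine tsum_congr fun a => ?_
  by_cases ha : a ∈ p.support
  · rw [h a ha]
  · rw [(PMF.apply_eq_zero_iff p a).2 ha]
    simp

theorem bind_congr_of_support {α β : Type*} {p : PMF α} {f g : α → PMF β}
    (h : ∀ a ∈ p.support, f a = g a) : p.bind f = p.bind g := by
  ext b
  rw [PMF.bind_apply, PMF.bind_apply]
  refine tsum_congr fun a => ?_
  by_cases ha : a ∈ p.support
  · rw [h a ha]
  · rw [(PMF.apply_eq_zero_iff p a).2 ha, zero_mul, zero_mul]

theorem expect_congr_of_support {α : Type u} [Fintype α] {p : PMF α} {f g : α → ℝ}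
    (h : ∀ a ∈ p.support, f a = g a) : expect p f = expect p g := by
  refine Finset.sum_congr rfl fun a _ => ?_
  by_cases ha : a ∈ p.support
  · rw [h a ha]
  · rw [(PMF.apply_eq_zero_iff p a).2 ha]
    simp

theorem expect_nonneg_of_support {α : Type u} [Fintype α] {p : PMF α} {f : α → ℝ}
    (h : ∀ a ∈ p.support, 0 ≤ f a) : 0 ≤ expect p f := by
  refine Finset.sum_nonneg fun a _ => ?_
  by_cases ha : a ∈ p.support
  · exact mul_nonneg ENNReal.toReal_nonneg (h a ha)
  · rw [(PMF.apply_eq_zero_iff p a).2 ha]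
    simp

/-- The alternative `c = some x` carries the induction: acceptance concerns the element revealed
last, which has already left `l`. -/
theorem OnlineAlg.mem_of_mem_support_run (f : Finset U → ℝ) (a : OnlineAlg U) :
    ∀ (c : Option U) (l : List U), ∀ xs ∈ (a.run f c l).support, ∀ x ∈ xs, x ∈ l ∨ c = some x := by
  induction a with
  | halt => intro c l xs hxs; simp_all [run]
  | next k ih =>
    intro c l xs hxs x hx
    cases l with
    | nil => simp_all [run]
    | cons e l =>
      rcases ih e (some e) l xs (by simpa [run] using hxs) x hx with h | h
      · exact Or.inl (List.mem_cons_of_mem _ h)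
      · rw [Option.some.inj h]
        exact Or.inl List.mem_cons_self
  | accept a ih =>
    intro c l xs hxs x hx
    cases c with
    | none => exact ih none l xs (by simpa [run] using hxs) x hx
    | some e =>
      rw [run, PMF.mem_support_map_iff] at hxs
      obtain ⟨ys, hys, rfl⟩ := hxs
      rcases List.mem_cons.1 hx with rfl | h
      · exact Or.inr rfl
      · exact ih (some e) l ys hys x h
  | query A k ih =>
    intro c l xs hxs x hx
    exact ih (f A) c l xs (by simpa [run] using hxs) x hx
  | toss p k ih =>
    intro c l xs hxs x hx
    rw [run, PMF.mem_support_bind_iff] at hxs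
    obtain ⟨i, _, hi⟩ := hxs
    exact ih i c l xs hi x hx

/-- An algorithm that only queries feasible sets of revealed elements cannot distinguish two oracles
that agree on these sets. -/
theorem OnlineAlg.run_congr [DecidableEq U] {F : Set (Finset U)} {R : Finset U}
    {f g : Finset U → ℝ} (hfg : ∀ X ∈ F, X ⊆ R → f X = g X) (a : OnlineAlg U) :
    ∀ (seen : Finset U) (c : Option U) (l : List U), a.QueriesOnly F seen → seen ⊆ R → l.Nodup →
      (∀ e ∈ l, e ∈ R ∧ e ∉ seen) → a.run f c l = a.run g c l := by
  induction a with
  | halt => intros; rfl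
  | next k ih =>
    intro seen c l hq hseen hnd hl
    cases l with
    | nil => rfl
    | cons e l =>
      obtain ⟨heR, hes⟩ := hl e List.mem_cons_self
      obtain ⟨hel, hnd⟩ := List.nodup_cons.1 hnd
      refine ih e (insert e seen) (some e) l (hq e hes) (Finset.insert_subset heR hseen) hnd
        fun x hx => ?_
      obtain ⟨hxR, hxs⟩ := hl x (List.mem_cons_of_mem _ hx)
      refine ⟨hxR, fun h => ?_⟩
      rcases Finset.mem_insert.1 h with rfl | h
      exacts [hel hx, hxs h]
  | accept a ih =>
    intro seen c l hq hseen hnd hl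
    cases c with
    | none => exact ih seen none l hq hseen hnd hl
    | some e => exact congrArg (PMF.map (e :: ·)) (ih seen (some e) l hq hseen hnd hl)
  | query A k ih =>
    intro seen c l hq hseen hnd hl
    have h := hfg A hq.1.1 (hq.1.2.trans hseen)
    change (k (f A)).run f c l = (k (g A)).run g c l
    rw [h]
    exact ih _ seen c l (hq.2 _) hseen hnd hl
  | toss p k ih =>
    intro seen c l hq hseen hnd hl
    exact bind_congr_of_support fun i hi => ih i seen c l (hq i hi) hseen hnd hl

variable [DecidableEq U]

theorem keepImproving_aux (f : Finset U → ℝ) (l : List U) : ∀ A : Finset U,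
    l.foldl (fun A e => open Classical in if f A ≤ f (insert e A) then insert e A else A) A ⊆
      A ∪ l.toFinset ∧
    f A ≤ f (l.foldl (fun A e => open Classical in
      if f A ≤ f (insert e A) then insert e A else A) A) := by
  induction l with
  | nil => intro A; simp
  | cons e l ih =>
    intro A
    rw [List.foldl_cons]
    split_ifs with h
    · obtain ⟨h1, h2⟩ := ih (insert e A)
      refine ⟨h1.trans (fun x => ?_), h.trans h2⟩
      simp only [Finset.mem_union, Finset.mem_insert, List.mem_toFinset, List.mem_cons]
      tauto
    · obtain ⟨h1, h2⟩ := ih A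
      refine ⟨h1.trans (fun x => ?_), h2⟩
      simp only [Finset.mem_union, List.mem_toFinset, List.mem_cons]
      tauto

theorem keepImproving_subset (f : Finset U → ℝ) (l : List U) :
    keepImproving f l ⊆ l.toFinset := by
  have h := (keepImproving_aux f l ∅).1
  rwa [Finset.empty_union] at h

theorem le_keepImproving (f : Finset U → ℝ) (l : List U) : f ∅ ≤ f (keepImproving f l) :=
  (keepImproving_aux f l ∅).2

/-- For an objective monotone below the final set, no selected item is ever discarded. -/
theorem keepImproving_eq {f : Finset U → ℝ} {l : List U}
    (h : ∀ A B, A ⊆ B → B ⊆ l.toFinset → f A ≤ f B) : keepImproving f l = l.toFinset := by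
  have key : ∀ (m : List U) (A : Finset U), A ∪ m.toFinset ⊆ l.toFinset →
      m.foldl (fun A e => open Classical in if f A ≤ f (insert e A) then insert e A else A) A =
        A ∪ m.toFinset := by
    intro m
    induction m with
    | nil => intro A _; simp
    | cons e m ih =>
      intro A hA
      have hins : A ∪ (e :: m).toFinset = insert e A ∪ m.toFinset := by
        ext x
        simp only [Finset.mem_union, Finset.mem_insert, List.mem_toFinset, List.mem_cons]
        tauto
      rw [hins] at hA ⊢
      rw [List.foldl_cons,
        if_pos (h A (insert e A) (Finset.subset_insert _ _) (Finset.subset_union_left.trans hA))]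
      exact ih _ hA
  have h1 := key l ∅ (by simp)
  rwa [Finset.empty_union] at h1

end Run

namespace Instance

section Algorithm

variable {d : ℕ} {U : Type u} [Fintype U] [DecidableEq U] {I : Instance d U}
  {alg : ℕ → OnlineAlg U} {α : ℝ}

/-- The output of the algorithm after the sampling phase, on the sequence `r` of picked items. -/
def selection (I : Instance d U) (alg : ℕ → OnlineAlg U) (r : List U) : PMF (Finset U) :=
  ((alg r.length).run I.profit none r).map (keepImproving I.profit)

theorem feasible_of_mem_selection (hI : I.WellFormed) (halg : IsCompetitive I.feasible α alg)
    {r : List U} (hr : r.Nodup) {A : Finset U} (hA : A ∈ (I.selection alg r).support) :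
    A ∈ I.feasible := by
  rw [selection, PMF.mem_support_map_iff] at hA
  obtain ⟨xs, hxs, rfl⟩ := hA
  exact hI.down_closed _ (halg.returns_feasible _ r hr xs hxs) _ (keepImproving_subset _ _)

theorem profit_empty (hg : NiceCost I.cost) : I.profit ∅ = 0 := by
  simp [profit, hg.map_zero]

/-- Discarding harmful items keeps the profit at least that of the empty set, so even bad samples
cost nothing. -/
theorem expect_selection_nonneg (hg : NiceCost I.cost) (r : List U) :
    0 ≤ expect (I.selection alg r) I.profit := by
  refine expect_nonneg_of_support fun A hA => ?_
  rw [selection, PMF.mem_support_map_iff] at hA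
  obtain ⟨xs, _, rfl⟩ := hA
  exact profit_empty hg ▸ le_keepImproving I.profit xs

/-- The subroutine keeps its guarantee on picked items when no feasible set overflows. -/
theorem opt_le_expect_selection (hI : I.WellFormed) (hg : NiceCost I.cost)
    (hs : Separable I.cost) (halg : IsCompetitive I.feasible α alg) {μ : Fin d → ℝ}
    {R : Finset U} (hR : ∀ e ∈ R, I.load μ e ≤ I.value e)
    (hno : ∀ X ∈ I.feasible, X ⊆ R → I.NoOverflow μ X) :
    1 / α * I.opt R ≤
      (∑ r ∈ orders R, expect (I.selection alg r) I.profit) / R.card.factorial := by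
  obtain ⟨f, hf, hfR⟩ := exists_monotoneSubmodular hI hg hs hR hno
  obtain ⟨X, hX, hXR, hopt⟩ := exists_profit_eq_opt hI R
  have h := halg.competitive f hf R X hX hXR
  rw [expect_randomOrder_bind, hfR X hX hXR, hopt] at h
  refine h.trans (le_of_eq ?_)
  congr 1
  refine Finset.sum_congr rfl fun r hr => ?_
  obtain ⟨hnd, hrR⟩ := mem_orders.1 hr
  -- The guarantee was obtained for `f`; the algorithm queries `profit`, but the two agree on every
  -- set it may query.
  have hrun : (alg r.length).run f none r = (alg r.length).run I.profit none r :=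
    OnlineAlg.run_congr hfR _ ∅ none r (halg.queries_feasible _) (Finset.empty_subset _) hnd
      fun e he => ⟨hrR ▸ List.mem_toFinset.2 he, Finset.notMem_empty e⟩
  rw [← length_of_mem_orders hr, hrun, selection]
  have hout : ∀ xs ∈ ((alg r.length).run I.profit none r).support,
      xs.toFinset ∈ I.feasible ∧ xs.toFinset ⊆ R := by
    intro xs hxs
    refine ⟨halg.returns_feasible _ r hnd xs hxs, fun e he => ?_⟩
    rcases OnlineAlg.mem_of_mem_support_run _ _ _ _ xs hxs e (List.mem_toFinset.1 he) with h | h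
    · exact hrR ▸ List.mem_toFinset.2 h
    · simp at h
  have hkeep : ((alg r.length).run I.profit none r).map (keepImproving I.profit) =
      ((alg r.length).run I.profit none r).map List.toFinset := by
    refine map_congr_of_support fun xs hxs => keepImproving_eq fun A B hAB hB => ?_
    obtain ⟨h1, h2⟩ := hout xs hxs
    have hBF := hI.down_closed _ h1 B hB
    rw [← hfR A (hI.down_closed _ hBF A hAB) ((hAB.trans hB).trans h2),
      ← hfR B hBF (hB.trans h2)]
    exact hf.mono A B hAB
  rw [hkeep]
  refine expect_congr_of_support fun A hA => ?_
  rw [PMF.mem_support_map_iff] at hA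
  obtain ⟨xs, hxs, rfl⟩ := hA
  exact hfR _ (hout xs hxs).1 (hout xs hxs).2

theorem feasible_of_mem_onlineAlgorithm (hI : I.WellFormed)
    (halg : IsCompetitive I.feasible α alg) (thr : Finset U → Fin d → ℝ) :
    ∀ A ∈ (I.onlineAlgorithm thr alg).support, A ∈ I.feasible := by
  classical
  intro A hA
  rw [onlineAlgorithm, PMF.mem_support_bind_iff] at hA
  obtain ⟨σ, hσ, hA⟩ := hA
  rw [PMF.mem_support_bind_iff] at hA
  obtain ⟨k, _, hA⟩ := hA
  have hσ' : σ ∈ orders (Finset.univ : Finset U) := by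
    rwa [randomOrder, PMF.mem_support_uniformOfFinset_iff] at hσ
  exact feasible_of_mem_selection hI halg
    (((mem_orders.1 hσ').1.sublist (List.drop_sublist _ _)).filter _) hA

/-- The sample becomes a uniformly random subset `S`, and given `S` the items passed on come in
uniformly random order, as the subroutine requires. -/
theorem expect_onlineAlgorithm (thr : Finset U → Fin d → ℝ) :
    expect (I.onlineAlgorithm thr alg) I.profit =
      (∑ S : Finset U, (∑ r ∈ orders (I.strictPicked Sᶜ (thr S)),
        expect (I.selection alg r) I.profit) /
          ((I.strictPicked Sᶜ (thr S)).card.factorial : ℝ)) / 2 ^ Fintype.card U := by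
  classical
  rw [onlineAlgorithm, expect_randomOrder_bind]
  simp only [expect_binomialHalf_bind]
  have h := sum_orders_univ_binomial (U := U) fun S l =>
    expect (I.selection alg (l.filter fun e => I.load (thr S) e < I.value e)) I.profit
  rw [Finset.card_univ]
  refine Eq.trans ?_ (h.trans ?_)
  · rfl
  · congr 1
    refine Finset.sum_congr rfl fun S _ => ?_
    exact sum_orders_filter Sᶜ (fun e => I.load (thr S) e < I.value e)
      fun r => expect (I.selection alg r) I.profit

end Algorithm

end Instance

/-! ### Good samples -/

namespace Instance

section Main

variable {d : ℕ} {U : Type u} [Fintype U] [DecidableEq U] {I : Instance d U}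
  {alg : ℕ → OnlineAlg U} {α : ℝ} {C : Set (Fin d → ℝ)} {γ : ℝ≥0 → Fin d → ℝ}

/-- At most one picked item is not strictly picked. -/
theorem fopt_picked_le (hI : I.WellFormed) (hg : NiceCost I.cost) (hs : Separable I.cost) {M : ℝ}
    (hM0 : 0 ≤ M)
    (hM : ∀ e, ∀ t ∈ Icc (0 : ℝ) 1, t * I.value e - I.cost (t • I.size e) ≤ M)
    {μ : Fin d → ℝ} (hμ : {e | I.value e = I.load μ e}.Subsingleton) (A : Finset U) :
    I.fopt (I.picked A μ) ≤ I.fopt (I.strictPicked A μ) + M := by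
  by_cases h : ∃ a, I.value a = I.load μ a
  · obtain ⟨a, ha⟩ := h
    refine (fopt_mono hI hg fun e he => ?_).trans (fopt_insert_le hI hg hs hM _ a)
    obtain ⟨heA, he⟩ := mem_picked.1 he
    rcases he.eq_or_lt with h | h
    · rw [hμ (show e ∈ {e | I.value e = I.load μ e} from h.symm) ha]
      exact Finset.mem_insert_self _ _
    · exact Finset.mem_insert_of_mem (mem_strictPicked.2 ⟨heA, h⟩)
  · refine (fopt_mono hI hg fun e he => ?_).trans (le_add_of_nonneg_right hM0)
    obtain ⟨heA, he⟩ := mem_picked.1 he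
    exact mem_strictPicked.2 ⟨heA, he.lt_of_ne fun h' => h ⟨e, h'.symm⟩⟩

theorem picked_univ_inter (A : Finset U) (μ : Fin d → ℝ) :
    I.picked Finset.univ μ ∩ A = I.picked A μ := by
  ext e
  simp only [Finset.mem_inter, mem_picked, Finset.mem_univ, true_and]
  exact and_comm

/-- A threshold rule returns the point of the curve at the last time the demand is met. -/
theorem IsThresholdRule.isGreatest (hI : I.WellFormed) (hg : NiceCost I.cost) (hd : 0 < d)
    (hγ : Continuous γ) (hγm : Monotone γ) (hγ0 : γ 0 = 0)
    (hγt : ∀ i, Tendsto (fun t => γ t i) atTop atTop) {thr : Finset U → Fin d → ℝ}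
    (hthr : I.IsThresholdRule (range γ) thr) {S : Finset U} (hS : 0 < I.fopt S) :
    IsGreatest {μ | μ ∈ range γ ∧ 1 / (12 * (d : ℝ)) * I.fopt S ≤ I.fopt (I.picked S μ)}
      (thr S) := by
  have hd' : (1 : ℝ) ≤ d := by exact_mod_cast hd
  have hpos : 0 < 1 / (12 * (d : ℝ)) * I.fopt S := by positivity
  have hle : 1 / (12 * (d : ℝ)) * I.fopt S ≤ I.fopt S := by
    refine mul_le_of_le_one_left hS.le ?_
    rw [div_le_one (by positivity)]
    linarith
  obtain ⟨t, ht⟩ := exists_isGreatest_time (A := S) hI hg hγ hγm hγ0 hγt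
    (lowerSemicontinuous_const (z := 1 / (12 * (d : ℝ)) * I.fopt S)) hle
    (Eventually.of_forall fun _ => hpos)
  refine hthr S ⟨γ t, ⟨⟨t, rfl⟩, ht.1⟩, ?_⟩
  rintro _ ⟨⟨s, rfl⟩, hs⟩
  exact hγm (ht.2 hs)

/-- A sample is good for the thresholds `γ t₀` and `γ t₁` if it keeps a constant fraction of the
relevant fractional optima. -/
theorem le_expect_of_good (hI : I.WellFormed) (hg : NiceCost I.cost) (hs : Separable I.cost)
    (hd : 0 < d) (hγ : Continuous γ) (hγm : Monotone γ) (hγ0 : γ 0 = 0)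
    (hγt : ∀ i, Tendsto (fun t => γ t i) atTop atTop)
    (hγb : ∀ t i j, marginalDual I.cost i (γ t i) = marginalDual I.cost j (γ t j))
    (hgp : I.GeneralPosition (range γ)) {thr : Finset U → Fin d → ℝ}
    (hthr : I.IsThresholdRule (range γ) thr) (hα : 0 < α)
    (halg : IsCompetitive I.feasible α alg) {M F : ℝ} (hM0 : 0 ≤ M)
    (hM : ∀ e, ∀ t ∈ Icc (0 : ℝ) 1, t * I.value e - I.cost (t • I.size e) ≤ M)
    (hF : I.fopt Finset.univ = F) (hFpos : 0 < F) (hMF : M ≤ F / (10 ^ 4 * d)) {i : Fin d}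
    {t₀ t₁ : ℝ≥0} (ht₀ : IsGreatest {t | marginalDual I.cost i (γ t i) ≤
      I.fopt (I.picked Finset.univ (γ t))} t₀)
    (hF₀ : F / (2 * d) ≤ I.fopt (I.picked Finset.univ (γ t₀)))
    (ht₁ : IsGreatest {t | F / (72 * d) ≤ I.fopt (I.picked Finset.univ (γ t))} t₁)
    {S : Finset U} (hS : F / 6 ≤ I.fopt S)
    (hS₀ : I.fopt (I.picked Finset.univ (γ t₀)) / 6 ≤ I.fopt (I.picked S (γ t₀)))
    (hS₁ : I.fopt (I.picked Finset.univ (γ t₁)) / 6 ≤ I.fopt (I.picked Sᶜ (γ t₁))) :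
    1 / α * (F / (1000 * d ^ 2)) ≤ (∑ r ∈ orders (I.strictPicked Sᶜ (thr S)),
        expect (I.selection alg r) I.profit) /
          ((I.strictPicked Sᶜ (thr S)).card.factorial : ℝ) := by
  have hd' : (1 : ℝ) ≤ d := by exact_mod_cast hd
  have hdpos : (0 : ℝ) < d := by linarith
  set D : ℝ := F / d with hD
  have hDpos : 0 < D := by positivity
  have e1 : F / (10 ^ 4 * d) = D / 10 ^ 4 := by rw [hD]; field_simp
  have e2 : F / (2 * d) = D / 2 := by rw [hD]; field_simp
  have e3 : F / (72 * d) = D / 72 := by rw [hD]; field_simp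
  have e4 : F / (1000 * d ^ 2) = D / (1000 * d) := by rw [hD]; field_simp
  have e5 : ∀ x : ℝ, 1 / (12 * (d : ℝ)) * x = x / d / 12 := fun x => by field_simp
  have hSF : I.fopt S ≤ F := hF ▸ fopt_mono hI hg (Finset.subset_univ S)
  have hSpos : 0 < I.fopt S := by linarith
  have hgr := hthr.isGreatest hI hg hd hγ hγm hγ0 hγt hSpos
  obtain ⟨⟨s, hsμ⟩, hsS⟩ := hgr.1
  rw [← hsμ] at hsS ⊢
  have hSD : I.fopt S / d ≤ D := div_le_div_of_nonneg_right hSF hdpos.le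
  have hSD' : D / 6 ≤ I.fopt S / d := by
    rw [hD, div_right_comm]
    exact div_le_div_of_nonneg_right hS hdpos.le
  -- The sample keeps a sixth of `fopt(A₀) ≥ F / (2d)`, that is `F / (12 d)`, so `γ t₀` is a
  -- candidate for the threshold.
  have hle₀ : γ t₀ ≤ γ s := by
    rw [hsμ]
    refine hgr.2 ⟨⟨t₀, rfl⟩, ?_⟩
    rw [e5]
    rw [e2] at hF₀
    linarith
  -- The items picked at `s` have `fopt` at least `fopt(S) / (12 d) ≥ F / (72 d)`.
  have hle₁ : s ≤ t₁ := by
    refine ht₁.2 ?_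
    have h := fopt_mono hI hg (picked_subset_picked hI (Finset.subset_univ S) (le_refl (γ s)))
    rw [e5] at hsS
    change F / (72 * d) ≤ _
    rw [e3]
    linarith
  -- The curve may pause, so the parameter `s` of the threshold could precede `t₀`; the point is
  -- then the same as at `t₀`.
  obtain ⟨t, htt₀, hts⟩ : ∃ t, t₀ ≤ t ∧ γ t = γ s := by
    rcases le_total t₀ s with h | h
    · exact ⟨s, h, rfl⟩
    · exact ⟨t₀, le_rfl, hle₀.antisymm (hγm h)⟩
  set R := I.strictPicked Sᶜ (γ s) with hR
  have hRe : ∀ e ∈ R, I.load (γ s) e ≤ I.value e := fun e he => (mem_strictPicked.1 he).2.le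
  have hno : ∀ X ∈ I.feasible, X ⊆ R → I.NoOverflow (γ s) X := by
    intro X hX hXR
    rw [← hts]
    refine noOverflow_of_le hI hg hs hγ hγb ht₀ htt₀ hX fun e he => ?_
    rw [hts]
    exact mem_strictPicked.2 ⟨Finset.mem_univ e, (mem_strictPicked.1 (hXR he)).2⟩
  refine le_trans (mul_le_mul_of_nonneg_left ?_ (by positivity))
    (opt_le_expect_selection hI hg hs halg hRe hno)
  have h1 := fopt_le_mul_opt hI hg hs hRe hno
  have h2 : I.fopt (I.picked Sᶜ (γ t₁)) ≤ I.fopt R + M :=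
    (fopt_mono hI hg (picked_subset_picked hI subset_rfl (hγm hle₁))).trans
      (fopt_picked_le hI hg hs hM0 hM (hgp _ ⟨s, rfl⟩) _)
  have h3 : F / (72 * d) ≤ I.fopt (I.picked Finset.univ (γ t₁)) := ht₁.1
  rw [e3] at h3
  rw [e1] at hMF
  -- `fopt(R)` is at least `D / 432 - D / 10 ^ 4`, with `432 = 6 · 72`; the subtracted term pays for
  -- the at most one item on the classifier boundary.
  have h4 : D / 500 ≤ (d + 1) * I.opt R := by linarith
  have h5 : ((d : ℝ) + 1) * I.opt R ≤ (2 * d) * I.opt R :=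
    mul_le_mul_of_nonneg_right (by linarith) (opt_nonneg hI hg R)
  rw [e4, div_le_iff₀ (by positivity)]
  linarith

theorem opt_le_mul_expect (hI : I.WellFormed) (hg : NiceCost I.cost) (hs : Separable I.cost)
    (hd : 0 < d) (hC : IsClassifierCurve I.cost C) (hgp : I.GeneralPosition C)
    (hex : ∀ e, ¬ I.Exceptional e) {η : ℝ} (hη : 10 ^ 4 ≤ η)
    (hsmall : ∀ e, I.profit {e} ≤ I.opt Finset.univ / (η * d)) {thr : Finset U → Fin d → ℝ}
    (hthr : I.IsThresholdRule C thr) (hα : 0 < α) (halg : IsCompetitive I.feasible α alg) :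
    I.opt Finset.univ ≤
      2000 * α * (d : ℝ) ^ 2 * expect (I.onlineAlgorithm thr alg) I.profit := by
  obtain ⟨γ, hγ, hγm, hγ0, hγt, hγb, rfl⟩ := hC
  have hd' : (1 : ℝ) ≤ d := by exact_mod_cast hd
  have hdpos : (0 : ℝ) < d := by linarith
  rw [expect_onlineAlgorithm]
  set n := Fintype.card U with hn
  set E : Finset U → ℝ := fun S => (∑ r ∈ orders (I.strictPicked Sᶜ (thr S)),
    expect (I.selection alg r) I.profit) /
      ((I.strictPicked Sᶜ (thr S)).card.factorial : ℝ) with hE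
  have hE0 : ∀ S, 0 ≤ E S := fun S => div_nonneg
    (Finset.sum_nonneg fun r _ => expect_selection_nonneg hg r) (Nat.cast_nonneg _)
  -- With `opt = 0` the threshold may be arbitrary, but nonnegativity of the outcome suffices.
  rcases (opt_nonneg hI hg (Finset.univ : Finset U)).eq_or_lt with h0 | hopt
  · rw [← h0]
    have := Finset.sum_nonneg fun S (_ : S ∈ Finset.univ) => hE0 S
    positivity
  set F := I.fopt Finset.univ with hF
  have hoptF : I.opt Finset.univ ≤ F := opt_le_fopt hI hg _
  have hFpos : 0 < F := hopt.trans_le hoptF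
  set M := I.opt Finset.univ / (10 ^ 4 * d) with hMdef
  have hM0 : 0 ≤ M := by positivity
  have hMF : M ≤ F / (10 ^ 4 * d) := div_le_div_of_nonneg_right hoptF (by positivity)
  have hM : ∀ e, ∀ t ∈ Icc (0 : ℝ) 1, t * I.value e - I.cost (t • I.size e) ≤ M := fun e =>
    fraction_le_of_not_exceptional hI hg (hex e) hM0 ((hsmall e).trans
      (div_le_div_of_nonneg_left hopt.le (by positivity)
        (mul_le_mul_of_nonneg_right hη hdpos.le)))
  obtain ⟨t₀, ht₀⟩ := exists_isGreatest_balance hI hg hγ hγm hγ0 hγt ⟨0, hd⟩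
  set A₀ := I.picked Finset.univ (γ t₀) with hA₀
  have hF₀ : F / (2 * d) ≤ I.fopt A₀ := by
    have h1 := fopt_univ_le hI hg hs (fun X hX hXt => noOverflow_of_le hI hg hs hγ hγb ht₀
      le_rfl hX hXt) (c := marginalDual I.cost ⟨0, hd⟩ (γ t₀ ⟨0, hd⟩)) fun j => (hγb t₀ j _).le
    have h2 : marginalDual I.cost ⟨0, hd⟩ (γ t₀ ⟨0, hd⟩) ≤ I.fopt A₀ := ht₀.1
    have h3 : I.fopt (I.strictPicked Finset.univ (γ t₀)) ≤ I.fopt A₀ :=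
      fopt_mono hI hg strictPicked_subset_picked
    have h4 := mul_le_mul_of_nonneg_left h2 hdpos.le
    have h5 := mul_le_mul_of_nonneg_right hd' (fopt_nonneg hI hg A₀)
    rw [div_le_iff₀ (by positivity)]
    linarith
  -- Here `72 = 6 · 12`: a good sample keeps a sixth of `F`, and the threshold asks for a `1 / (12
  -- d)` fraction of that.
  obtain ⟨t₁, ht₁⟩ := exists_isGreatest_time (A := Finset.univ) hI hg hγ hγm hγ0 hγt
    (lowerSemicontinuous_const (z := F / (72 * d))) (div_le_self hFpos.le (by linarith))
    (Eventually.of_forall fun _ => by positivity)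
  set A₁ := I.picked Finset.univ (γ t₁) with hA₁
  have hF₁ : F / (72 * d) ≤ I.fopt A₁ := ht₁.1
  set bad : Finset U → Finset (Finset U) := fun A => Finset.univ.filter fun S : Finset U =>
      I.fopt (A ∩ S) < I.fopt A / 6 ∨ I.fopt (A ∩ Sᶜ) < I.fopt A / 6 with hbad
  have hcard : ∀ A, F / (72 * d) ≤ I.fopt A → ((bad A).card : ℝ) ≤ 2 ^ n / 6 := by
    intro A hA
    have hApos : 0 < I.fopt A := lt_of_lt_of_le (by positivity) hA
    have h1 := card_fopt_deviation_mul_le hI hg hs hM A hApos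
    -- Since `54 = 9 · 6`, this turns the Chebyshev bound into a failure probability of at most 1/6.
    have h2 : 54 * M ≤ 4 * I.fopt A := by
      have e1 : F / (10 ^ 4 * d) = F / d / 10 ^ 4 := by field_simp
      have e2 : F / (72 * d) = F / d / 72 := by field_simp
      rw [e1] at hMF
      rw [e2] at hA
      have : 0 < F / d := by positivity
      linarith
    have h3 : 4 * I.fopt A * ((bad A).card : ℝ) ≤ 4 * I.fopt A * (2 ^ n / 6) := by
      refine h1.trans ?_
      have := mul_le_mul_of_nonneg_right h2 (show (0 : ℝ) ≤ 2 ^ n / 6 by positivity)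
      linarith
    exact le_of_mul_le_mul_left h3 (by positivity)
  -- Three events of probability at most 1/6 each leave at least half of the samples good.
  set G := Finset.univ \ (bad Finset.univ ∪ bad A₀ ∪ bad A₁) with hG
  have hGcard : (2 : ℝ) ^ n / 2 ≤ G.card := by
    have h1 := hcard Finset.univ (div_le_self hFpos.le (by linarith))
    have h2 := hcard A₀ (le_trans (div_le_div_of_nonneg_left hFpos.le (by positivity)
      (by linarith)) hF₀)
    have h3 := hcard A₁ hF₁
    have h4 : (bad Finset.univ ∪ bad A₀ ∪ bad A₁).card ≤
        (bad Finset.univ).card + (bad A₀).card + (bad A₁).card :=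
      (Finset.card_union_le _ _).trans (Nat.add_le_add_right (Finset.card_union_le _ _) _)
    have h4' : ((bad Finset.univ ∪ bad A₀ ∪ bad A₁).card : ℝ) ≤
        (bad Finset.univ).card + (bad A₀).card + (bad A₁).card := by exact_mod_cast h4
    have h5 := Finset.card_sdiff_add_card_eq_card
      (Finset.subset_univ (bad Finset.univ ∪ bad A₀ ∪ bad A₁))
    rw [← hG, Finset.card_univ, Fintype.card_finset, ← hn] at h5
    have h5' : (G.card : ℝ) + (bad Finset.univ ∪ bad A₀ ∪ bad A₁).card = 2 ^ n := by
      exact_mod_cast h5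
    linarith
  have hgood : ∀ S ∈ G, 1 / α * (F / (1000 * d ^ 2)) ≤ E S := by
    intro S hS
    simp only [hG, hbad, Finset.mem_sdiff, Finset.mem_union, Finset.mem_filter, Finset.mem_univ,
      true_and, not_or, not_lt, Finset.univ_inter] at hS
    obtain ⟨⟨⟨h1, _⟩, h2, _⟩, _, h3⟩ := hS
    rw [hA₀, picked_univ_inter] at h2
    rw [hA₁, picked_univ_inter] at h3
    exact le_expect_of_good hI hg hs hd hγ hγm hγ0 hγt hγb hgp hthr hα halg hM0 hM hF.symm hFpos
      hMF ht₀ hF₀ ht₁ h1 h2 h3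
  have hsum : (2 : ℝ) ^ n / 2 * (1 / α * (F / (1000 * d ^ 2))) ≤ ∑ S, E S := by
    calc (2 : ℝ) ^ n / 2 * (1 / α * (F / (1000 * d ^ 2)))
        ≤ G.card * (1 / α * (F / (1000 * d ^ 2))) :=
          mul_le_mul_of_nonneg_right hGcard (by positivity)
      _ = ∑ S ∈ G, 1 / α * (F / (1000 * d ^ 2)) := by rw [Finset.sum_const, nsmul_eq_mul]
      _ ≤ ∑ S ∈ G, E S := Finset.sum_le_sum hgood
      _ ≤ ∑ S, E S := Finset.sum_le_sum_of_subset_of_nonneg (Finset.subset_univ G)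
          fun S _ _ => hE0 S
  -- The constant is `2000 = 2 · 1000`: probability 1/2 of a good sample, and profit at least `F /
  -- (1000 α d²)` on it.
  have hfinal : F = 2000 * α * d ^ 2 *
      (((2 : ℝ) ^ n / 2 * (1 / α * (F / (1000 * d ^ 2)))) / 2 ^ n) := by
    field_simp
    norm_num
  refine hoptF.trans (hfinal.le.trans (mul_le_mul_of_nonneg_left ?_ (by positivity)))
  exact div_le_div_of_nonneg_right hsum (by positivity)

end Main

end Instance

end ConvexProfit

end

theorem mainTheorem4 :
    ∃ K : ℝ, 0 < K ∧
      ∀ (d : ℕ) (_ : 0 < d) (U : Type*) [Fintype U] [DecidableEq U]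
        (I : ConvexProfit.Instance d U) (_ : I.WellFormed)
        (_ : ConvexProfit.NiceCost I.cost) (_ : ConvexProfit.Separable I.cost)
        (C : Set (Fin d → ℝ)) (_ : ConvexProfit.IsClassifierCurve I.cost C)
        (_ : I.GeneralPosition C) (_ : ∀ e, ¬ I.Exceptional e)
        (η : ℝ) (_ : 10 ^ 4 ≤ η)
        (_ : ∀ e, I.profit {e} ≤ I.opt Finset.univ / (η * d))
        (thr : Finset U → Fin d → ℝ) (_ : I.IsThresholdRule C thr)
        (α : ℝ) (_ : 0 < α) (submodMS : ℕ → ConvexProfit.OnlineAlg U)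
        (_ : ConvexProfit.IsCompetitive I.feasible α submodMS),
        (∀ A ∈ (I.onlineAlgorithm thr submodMS).support, A ∈ I.feasible) ∧
          I.opt Finset.univ ≤
            K * α * (d : ℝ) ^ 2 *
              ConvexProfit.expect (I.onlineAlgorithm thr submodMS) I.profit := by
  refine ⟨2000, by norm_num, ?_⟩
  intro d hd U _ _ I hI hg hs C hC hgp hex η hη hsmall thr hthr α hα alg halg
  exact ⟨I.feasible_of_mem_onlineAlgorithm hI halg thr,
    I.opt_le_mul_expect hI hg hs hd hC hgp hex hη hsmall hthr hα halg⟩
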